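/- Let $n\in\mathbb N$. For a symmetric positive definite $A\in\mathbb{R}^{n\times n}$ let $\mu_A$ be the Gaussian measure $d\mu_A(x)=\frac{\sqrt{\det A}}{(2\pi)^{n/2}}e^{-\frac12x^\intercal Ax}\,dx$ on $\mathbb{R}^n$, and for symmetric positive definite $B$ let $d\nu_{A,B}=f_{A,B}\,d\mu_A$ with $f_{A,B}(x)=c_0e^{-\frac12x^\intercal Bx}$ and $c_0=\left(\int e^{-\frac12y^\intercal By}d\mu_A(y)\right)^{-1}$. For a density $f$ and $t\ge0$ put (Mehler formula) $P^A_tf(x)=\int f\left(e^{-tA}x+\sqrt{\mathrm{Id}-e^{-2tA}}\,y\right)d\mu_A(y)$ and $w_t=-\nabla\log P^A_tf$. A *Kim–Milman map* from $\mu_A$ to $f\mu_A$ is a map $T:\mathbb{R}^n\to\mathbb{R}^n$ for which there are a locally Lipschitz family of diffeomorphisms $(S_t)_{t\ge0}$ of $\mathbb{R}^n$ with $\frac{d}{dt}S_t(x)=w_t(S_t(x))$, $S_0(x)=x$, and times $t_k\to\infty$ such that $S_{t_k}^{-1}\to T$ uniformly on compact sets. A *Brenier map* from $\mu$ to $\nu$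 is a measurable map that pushes $\mu$ forward to $\nu$ and equals $\mu$-almost everywhere the gradient of a convex function $\varphi:\mathbb{R}^n\to\mathbb{R}$. 1. For all symmetric positive definite $A,B\in\mathbb{R}^{n\times n}$ there is exactly one Kim–Milman map from $\mu_A$ to $\nu_{A,B}$; it is $1$-Lipschitz and pushes $\mu_A$ forward to $\nu_{A,B}$; and there is a Brenier map from $\mu_A$ to $\nu_{A,B}$. 2. For all symmetric positive definite $A,B$ with $AB\ne BA$ there are $t\ge0$ and a symmetric positive definite $B'$ with $AB'\ne B'A$ and $P^A_tf_{A,B}=f_{A,B'}$, such that the Kim–Milman map from $\mu_A$ to $\nu_{A,B'}$ does not coincide $\mu_A$-almost everywhere with any Brenier map from $\mu_A$ to $\nu_{A,B'}$. 3. In particular, if $n\ge2$, there are symmetric positive definite $A,B\in\mathbb{R}^{n\times n}$ with $AB\neq BA$ for which the Kim–Milman map from $\mu_A$ to $\nu_{A,B}$ does not coincide $\mu_A$-almost everywhere with any Brenier map from $\mu_A$ to $\nu_{A,B}$. Thus the Kim–Milman map is in general different from the Brenier map. -/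

import Mathlib

open MeasureTheory Filter Topology
open scoped MatrixOrder ContDiff

noncomputable section

namespace KimMilman

/-- `ℝⁿ` with its Euclidean structure and Lebesgue measure. -/
abbrev Space (n : ℕ) : Type := EuclideanSpace ℝ (Fin n)

variable {n : ℕ}

/-- The product `M x` of a matrix and a vector of `ℝⁿ`. -/
def app (M : Matrix (Fin n) (Fin n) ℝ) (x : Space n) : Space n :=
  Matrix.toEuclideanCLM (𝕜 := ℝ) M x

/-- The quadratic form `xᵀ M x`. -/
def quad (M : Matrix (Fin n) (Fin n) ℝ) (x : Space n) : ℝ :=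
  inner ℝ x (app M x)

/-- The centred Gaussian measure with precision matrix `A`. -/
def gaussian (A : Matrix (Fin n) (Fin n) ℝ) : Measure (Space n) :=
  volume.withDensity fun x =>
    ENNReal.ofReal (√A.det / (2 * Real.pi) ^ ((n : ℝ) / 2) * Real.exp (-(1 / 2) * quad A x))

/-- The density `c₀ exp (-½ xᵀ B x)` with respect to `gaussian A`, where `c₀` normalizes the
total mass to `1`. -/
def tiltDensity (A B : Matrix (Fin n) (Fin n) ℝ) (x : Space n) : ℝ :=
  (∫ y, Real.exp (-(1 / 2) * quad B y) ∂(gaussian A))⁻¹ * Real.exp (-(1 / 2) * quad B x)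

/-- The measure with density `f` with respect to `gaussian A`. -/
def target (A : Matrix (Fin n) (Fin n) ℝ) (f : Space n → ℝ) : Measure (Space n) :=
  (gaussian A).withDensity fun x => ENNReal.ofReal (f x)

/-- The semigroup `P_t^A` generated by `L = Δ - A x · ∇`, given by the Mehler formula
`P_t^A f (x) = ∫ f (e^{-tA} x + √(Id - e^{-2tA}) y) dμ(y)` with `μ = gaussian A`.
Here `CFC.sqrt` is the positive semidefinite square root of a positive semidefinite matrix. -/
def heatFlow (A : Matrix (Fin n) (Fin n) ℝ) (t : ℝ) (f : Space n → ℝ) (x : Space n) : ℝ :=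
  ∫ y, f (app (NormedSpace.exp (-t • A)) x
    + app (CFC.sqrt (1 - NormedSpace.exp (-(2 * t) • A))) y) ∂(gaussian A)

/-- The velocity field `w_t = -∇ log P_t^A f`. -/
def velocity (A : Matrix (Fin n) (Fin n) ℝ) (f : Space n → ℝ) (t : ℝ) (x : Space n) : Space n :=
  -gradient (fun z => Real.log (heatFlow A t f z)) x

/-- `S` is a locally Lipschitz family of diffeomorphisms `S_t`, `t ≥ 0`, with inverses `R_t`,
which solves `d/dt S_t(x) = w_t(S_t(x))`, `S_0(x) = x` (one-sided derivative at `t = 0`).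
Values at negative times are irrelevant. -/
structure IsFlow (w : ℝ → Space n → Space n) (S R : ℝ → Space n → Space n) : Prop where
  init : ∀ x, S 0 x = x
  ode : ∀ x, ∀ t, 0 ≤ t → HasDerivWithinAt (fun s => S s x) (w t (S t x)) (Set.Ici 0) t
  left_inv : ∀ t, 0 ≤ t → Function.LeftInverse (R t) (S t)
  right_inv : ∀ t, 0 ≤ t → Function.RightInverse (R t) (S t)
  smooth : ∀ t, 0 ≤ t → ContDiff ℝ ∞ (S t)
  smooth_inv : ∀ t, 0 ≤ t → ContDiff ℝ ∞ (R t)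
  locallyLipschitz :
    LocallyLipschitzOn (Set.Ici (0 : ℝ) ×ˢ Set.univ) fun p : ℝ × Space n => S p.1 p.2

/-- `T` is a Kim–Milman (heat-flow) map from `μ = gaussian A` to the measure with density `f`
with respect to `μ`: a limit, uniform on compact sets and along some sequence of times tending to
infinity, of the inverses of the flow of `w_t = -∇ log P_t^A f`. -/
def IsKimMilmanMap (A : Matrix (Fin n) (Fin n) ℝ) (f : Space n → ℝ) (T : Space n → Space n) :
    Prop :=
  ∃ S R : ℝ → Space n → Space n, IsFlow (velocity A f) S R ∧
    ∃ τ : ℕ → ℝ, Tendsto τ atTop atTop ∧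
      ∀ K : Set (Space n), IsCompact K → TendstoUniformlyOn (fun k => R (τ k)) T atTop K

/-- `T` is (a representative of) the Brenier map from `μ` to `ν`: it pushes `μ` forward to `ν`
and is `μ`-almost everywhere the gradient of a convex function. -/
structure IsBrenierMap (μ ν : Measure (Space n)) (T : Space n → Space n) : Prop where
  transport : MeasurePreserving T μ ν
  gradient_convex : ∃ φ : Space n → ℝ, ConvexOn ℝ Set.univ φ ∧ ∀ᵐ x ∂μ, HasGradientAt φ (T x) x

/-- Pairs `(A, B)` of symmetric positive definite matrices that do not commute. -/
def NonCommutingPair (A B : Matrix (Fin n) (Fin n) ℝ) : Prop :=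
  A.PosDef ∧ B.PosDef ∧ A * B ≠ B * A

/-- Every Kim–Milman map from `gaussian A` to the measure with density `tiltDensity A B` differs,
on a set of positive measure, from every Brenier map between the same measures. -/
def MapsDiffer (A B : Matrix (Fin n) (Fin n) ℝ) : Prop :=
  ∀ T T' : Space n → Space n, IsKimMilmanMap A (tiltDensity A B) T →
    IsBrenierMap (gaussian A) (target A (tiltDensity A B)) T' → ¬ T =ᵐ[gaussian A] T'

end KimMilman

end

noncomputable section

namespace KimMilman

open scoped Matrix Matrix.Norms.L2Operator

variable {n : ℕ} {A B M : Matrix (Fin n) (Fin n) ℝ}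

/-! ### Matrices acting on `ℝⁿ` and their quadratic forms. -/

section App

variable {x : Space n}

/-! Everything stays Gaussian. The target is the Gaussian with precision `A + B`
(`target_tiltDensity`), and the heat flow only moves `B` to `B_t`, where `A⁻¹ + B_t⁻¹ = e^{tA} (A⁻¹
+ B⁻¹) e^{tA}` (`heatFlow_tiltDensity`). Hence `w_t x = B_t x`, and the flow is the matrix solution
of `Φ' = B_t Φ`, `Φ_0 = 1`. Since `B_t ≥ 0`, the inverse `R_t` is a contraction; since `B_t` decays
exponentially, `R_t` converges to a matrix `T`, the only Kim–Milman map. The quantity `R_t (A +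
B_t)⁻¹ R_tᵀ` is conserved, so in the limit `T A⁻¹ Tᵀ = (A + B)⁻¹`, which is the transport property.

A linear map that is a.e. the gradient of a convex function is symmetric
(`transpose_eq_of_ae_hasGradientAt`). The Kim–Milman map started from `B_s` is `Φ_s T`. If it were a
Brenier map for every `s ≥ 0`, then `Φ_s T` would be symmetric for all such `s`; the value and
derivative at `s = 0` make `T` and `B T` symmetric, so `T` commutes with `B`. With `T (A + B) T =
A`, the commutator `X = AB - BA = [A + B, B]` satisfies `T X T = X`. All eigenvalues of `T` have
modulus below `1`, so `X = 0` (`mul_comm_of_symmetric_transport`). Thus a non-commuting pair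
produces a difference at some time along its own heat flow, and non-commutation persists along that
flow. -/

lemma app_mul (M N : Matrix (Fin n) (Fin n) ℝ) (x : Space n) :
    app (M * N) x = app M (app N x) := by
  simp [app]

@[simp] lemma app_one (x : Space n) : app 1 x = x := by simp [app]

lemma app_add (M N : Matrix (Fin n) (Fin n) ℝ) (x : Space n) :
    app (M + N) x = app M x + app N x := by simp [app]

lemma app_sub (M N : Matrix (Fin n) (Fin n) ℝ) (x : Space n) :
    app (M - N) x = app M x - app N x := by simp [app]

lemma app_neg (M : Matrix (Fin n) (Fin n) ℝ) (x : Space n) : app (-M) x = -app M x := by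
  simp [app]

lemma app_map_add (M : Matrix (Fin n) (Fin n) ℝ) (x y : Space n) :
    app M (x + y) = app M x + app M y := by simp [app]

lemma app_map_sub (M : Matrix (Fin n) (Fin n) ℝ) (x y : Space n) :
    app M (x - y) = app M x - app M y := by simp [app]

lemma app_map_smul (M : Matrix (Fin n) (Fin n) ℝ) (c : ℝ) (x : Space n) :
    app M (c • x) = c • app M x := by simp [app]

lemma app_injective : Function.Injective (app : Matrix (Fin n) (Fin n) ℝ → Space n → Space n) := by
  intro M N h
  apply (Matrix.toEuclideanCLM (n := Fin n) (𝕜 := ℝ)).injective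
  ext1 x
  exact congrFun h x

lemma inner_app_left (M : Matrix (Fin n) (Fin n) ℝ) (x y : Space n) :
    inner ℝ (app M x) y = inner ℝ x (app Mᵀ y) := by
  have h : Mᵀ = star M := by
    rw [Matrix.star_eq_conjTranspose, Matrix.conjTranspose_eq_transpose_of_trivial]
  rw [h, app, app, map_star, ContinuousLinearMap.star_eq_adjoint,
    ContinuousLinearMap.adjoint_inner_right]

lemma norm_app_le (M : Matrix (Fin n) (Fin n) ℝ) (x : Space n) : ‖app M x‖ ≤ ‖M‖ * ‖x‖ :=
  (Matrix.toEuclideanCLM (n := Fin n) (𝕜 := ℝ) M).le_opNorm x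

lemma norm_le_of_app (M : Matrix (Fin n) (Fin n) ℝ) {c : ℝ} (hc : 0 ≤ c)
    (h : ∀ x, ‖app M x‖ ≤ c * ‖x‖) : ‖M‖ ≤ c :=
  ContinuousLinearMap.opNorm_le_bound (Matrix.toEuclideanCLM (n := Fin n) (𝕜 := ℝ) M) hc h

lemma continuous_app (M : Matrix (Fin n) (Fin n) ℝ) : Continuous (app M) :=
  (Matrix.toEuclideanCLM (n := Fin n) (𝕜 := ℝ) M).continuous

lemma continuous_quad (M : Matrix (Fin n) (Fin n) ℝ) : Continuous (quad M) :=
  continuous_id.inner (continuous_app M)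

lemma quad_add (M N : Matrix (Fin n) (Fin n) ℝ) (x : Space n) :
    quad (M + N) x = quad M x + quad N x := by
  simp [quad, app_add, inner_add_right]

lemma quad_sub (M N : Matrix (Fin n) (Fin n) ℝ) (x : Space n) :
    quad (M - N) x = quad M x - quad N x := by
  simp [quad, app_sub, inner_sub_right]

lemma quad_one (x : Space n) : quad 1 x = ‖x‖ ^ 2 := by simp [quad]

lemma quad_app (M L : Matrix (Fin n) (Fin n) ℝ) (x : Space n) :
    quad M (app L x) = quad (Lᵀ * M * L) x := by
  rw [quad, quad, inner_app_left, ← app_mul, ← app_mul, mul_assoc]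

lemma quad_nonneg (hM : M.PosSemidef) (x : Space n) : 0 ≤ quad M x := by
  have := hM.dotProduct_mulVec_nonneg x.ofLp
  rw [quad, app, Matrix.inner_toEuclideanCLM]
  simpa using this

lemma quad_pos (hM : M.PosDef) (hx : x ≠ 0) : 0 < quad M x := by
  have := hM.dotProduct_mulVec_pos (x := x.ofLp) (by simpa using hx)
  rw [quad, app, Matrix.inner_toEuclideanCLM]
  simpa using this

lemma posSemidef_of_quad (hM : Mᵀ = M) (h : ∀ x, 0 ≤ quad M x) : M.PosSemidef := by
  refine Matrix.PosSemidef.of_dotProduct_mulVec_nonneg ?_ fun x => ?_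
  · rw [Matrix.IsHermitian, Matrix.conjTranspose_eq_transpose_of_trivial, hM]
  · have := h (WithLp.toLp 2 x)
    rw [quad, app, Matrix.inner_toEuclideanCLM] at this
    simpa using this

lemma transpose_eq_of_isHermitian (hM : M.IsHermitian) : Mᵀ = M := by
  rw [← Matrix.conjTranspose_eq_transpose_of_trivial]; exact hM

/-- The constant is the minimum of the form on the unit sphere, extended by homogeneity. The trivial
space is separate because its sphere is empty. -/
lemma exists_quad_lower_bound (hM : M.PosDef) : ∃ c > 0, ∀ x, c * ‖x‖ ^ 2 ≤ quad M x := by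
  rcases subsingleton_or_nontrivial (Space n) with hs | hs
  · exact ⟨1, one_pos, fun x => by simp [Subsingleton.elim x 0, quad]⟩
  obtain ⟨z, hz, hmin⟩ := (isCompact_sphere (0 : Space n) 1).exists_isMinOn
    ((NormedSpace.sphere_nonempty (x := (0 : Space n)) (r := 1)).2 zero_le_one)
    (continuous_quad M).continuousOn
  have hz0 : z ≠ 0 := by
    rintro rfl
    simp at hz
  refine ⟨quad M z, quad_pos hM hz0, fun x => ?_⟩
  rcases eq_or_ne x 0 with rfl | hx
  · simp [quad]
  have hx' : 0 < ‖x‖ := norm_pos_iff.2 hx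
  have h : quad M z ≤ quad M (‖x‖⁻¹ • x) := hmin (by simp [norm_smul, hx'.ne'])
  have h2 : quad M (‖x‖⁻¹ • x) = ‖x‖⁻¹ ^ 2 * quad M x := by
    simp only [quad, app_map_smul, inner_smul_left, inner_smul_right]
    simp; ring
  rw [h2] at h
  calc quad M z * ‖x‖ ^ 2 ≤ ‖x‖⁻¹ ^ 2 * quad M x * ‖x‖ ^ 2 := by gcongr
    _ = quad M x := by field_simp

lemma norm_inv_le_of_quad_lower_bound {c : ℝ} (hc : 0 < c) (hM : IsUnit M.det)
    (h : ∀ x, c * ‖x‖ ^ 2 ≤ quad M x) : ‖M⁻¹‖ ≤ c⁻¹ := by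
  refine norm_le_of_app _ (inv_nonneg.2 hc.le) fun x => ?_
  set y := app M⁻¹ x
  have hy : app M y = x := by rw [← app_mul, Matrix.mul_nonsing_inv _ hM, app_one]
  have h1 : c * ‖y‖ ^ 2 ≤ ‖y‖ * ‖x‖ := by
    refine (h y).trans ?_
    rw [quad, hy]
    exact real_inner_le_norm y x
  rcases (norm_nonneg y).eq_or_lt with h0 | h0
  · rw [← h0]; positivity
  · rw [inv_mul_eq_div, le_div_iff₀ hc]
    nlinarith

end App

/-! ### Linear differential equations by the Dyson series. -/

section LinearODE

variable {𝔸 : Type*} [NormedRing 𝔸] [NormedAlgebra ℝ 𝔸]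

/-- The terms of the Dyson series of the linear equation `X' = F X`, `X 0 = 1`. -/
def dyson (F : ℝ → 𝔸) : ℕ → ℝ → 𝔸
  | 0 => fun _ => 1
  | k + 1 => fun t => ∫ s in (0 : ℝ)..t, F s * dyson F k s

lemma continuous_dyson {F : ℝ → 𝔸} (hF : Continuous F) (k : ℕ) : Continuous (dyson F k) := by
  induction k with
  | zero => exact continuous_const
  | succ k ih =>
    exact intervalIntegral.continuous_primitive
      (fun a b => (hF.mul ih).intervalIntegrable a b) 0

lemma hasDerivAt_dyson_succ [CompleteSpace 𝔸] {F : ℝ → 𝔸} (hF : Continuous F) (k : ℕ) (t : ℝ) :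
    HasDerivAt (dyson F (k + 1)) (F t * dyson F k t) t :=
  (hF.mul (continuous_dyson hF k)).integral_hasStrictDerivAt 0 t |>.hasDerivAt

/-- The factor `‖1‖` is kept because it need not be `1`: for `n = 0` the matrix ring is trivial. -/
lemma norm_dyson_le {F : ℝ → 𝔸} {K : ℝ} (hK : ∀ t, ‖F t‖ ≤ K) (k : ℕ)
    (t : ℝ) : ‖dyson F k t‖ ≤ ‖(1 : 𝔸)‖ * (K * |t|) ^ k / k.factorial := by
  have hK0 : 0 ≤ K := (norm_nonneg _).trans (hK 0)
  induction k generalizing t with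
  | zero => simp [dyson]
  | succ k ih =>
    calc ‖dyson F (k + 1) t‖
        ≤ ∫ s in Set.uIoc 0 t, ‖(1 : 𝔸)‖ * K ^ (k + 1) / k.factorial * |s - 0| ^ k := by
          rw [dyson, intervalIntegral.norm_intervalIntegral_eq]
          refine norm_integral_le_of_norm_le (Continuous.integrableOn_uIoc (by fun_prop)) ?_
          refine Eventually.of_forall fun s => ?_
          calc ‖F s * dyson F k s‖ ≤ K * (‖(1 : 𝔸)‖ * (K * |s|) ^ k / k.factorial) :=
                (norm_mul_le _ _).trans (mul_le_mul (hK s) (ih s) (norm_nonneg _) hK0)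
            _ = _ := by rw [sub_zero, mul_pow]; ring
      _ = ‖(1 : 𝔸)‖ * (K * |t|) ^ (k + 1) / (k + 1).factorial := by
          rw [integral_const_mul, integral_pow_abs_sub_uIoc, Nat.factorial_succ, sub_zero]
          push_cast
          rw [mul_pow]
          field_simp

/-- Global solvability of linear differential equations in a Banach algebra. -/
theorem exists_linear_ode_solution [CompleteSpace 𝔸] {F : ℝ → 𝔸} (hF : Continuous F) {K : ℝ}
    (hK : ∀ t, ‖F t‖ ≤ K) :
    ∃ X : ℝ → 𝔸, X 0 = 1 ∧ ∀ t, HasDerivAt X (F t * X t) t := by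
  have hK0 : 0 ≤ K := (norm_nonneg _).trans (hK 0)
  have hsum : ∀ t, Summable fun k => dyson F k t := fun t =>
    .of_norm_bounded (((Real.summable_pow_div_factorial (K * |t|)).mul_left ‖(1 : 𝔸)‖).congr
      fun k => by ring) (norm_dyson_le hK · t)
  refine ⟨fun t => 1 + ∑' k, dyson F (k + 1) t, by simp [dyson], fun t => ?_⟩
  set r := |t| + 1
  have hu : Summable fun k : ℕ => K * ‖(1 : 𝔸)‖ * ((K * r) ^ k / k.factorial) :=
    (Real.summable_pow_div_factorial (K * r)).mul_left _
  have hderiv : HasDerivAt (fun t => ∑' k, dyson F (k + 1) t) (∑' k, F t * dyson F k t) t := by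
    refine hasDerivAt_tsum_of_isPreconnected (g := fun k => dyson F (k + 1))
      (g' := fun k s => F s * dyson F k s) (t := Metric.ball (0 : ℝ) r) (y₀ := (0 : ℝ)) hu
      Metric.isOpen_ball (convex_ball (0 : ℝ) r).isPreconnected
      (fun k s _ => hasDerivAt_dyson_succ hF k s) (fun k s hs => ?_) ?_ ?_ ?_
    · have hs' : |s| ≤ r := by simpa using (Metric.mem_ball.1 hs).le
      calc ‖F s * dyson F k s‖ ≤ K * (‖(1 : 𝔸)‖ * (K * |s|) ^ k / k.factorial) :=
            (norm_mul_le _ _).trans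
              (mul_le_mul (hK s) (norm_dyson_le hK k s) (norm_nonneg _) hK0)
        _ ≤ K * (‖(1 : 𝔸)‖ * (K * r) ^ k / k.factorial) := by gcongr
        _ = _ := by ring
    · simp only [Metric.mem_ball, dist_self, r]; positivity
    · exact (summable_nat_add_iff (f := fun k => dyson F k 0) 1).2 (hsum 0)
    · simp [r]
  have hval : ∑' k, F t * dyson F k t = F t * (1 + ∑' k, dyson F (k + 1) t) := by
    rw [(hsum t).tsum_mul_left, (hsum t).tsum_eq_zero_add]
    rfl
  rw [← hval]
  exact hderiv.const_add 1

end LinearODE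

/-! ### Gaussian integrals, and linear maps between Gaussians. -/

section GaussianIntegrals

lemma map_app_volume {L : Matrix (Fin n) (Fin n) ℝ} (hL : L.det ≠ 0) :
    (volume : Measure (Space n)).map (app L) = ENNReal.ofReal |L.det⁻¹| • volume := by
  have hdet : LinearMap.det (Matrix.toEuclideanLin L) = L.det := by
    rw [Matrix.toEuclideanLin_eq_toLin_orthonormal, LinearMap.det_toLin]
  have := Measure.map_linearMap_addHaar_eq_smul_addHaar (volume : Measure (Space n))
    (f := Matrix.toEuclideanLin L) (by rwa [hdet])
  rw [hdet] at this
  exact this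

lemma integral_comp_app {L : Matrix (Fin n) (Fin n) ℝ} (hL : L.det ≠ 0) {g : Space n → ℝ}
    (hg : Continuous g) : ∫ x, g (app L x) = |L.det|⁻¹ * ∫ x, g x := by
  rw [← integral_map (μ := (volume : Measure (Space n))) (f := g)
    (continuous_app L).measurable.aemeasurable hg.aestronglyMeasurable, map_app_volume hL,
    integral_smul_measure, ENNReal.toReal_ofReal (abs_nonneg _), abs_inv, smul_eq_mul]

lemma integral_exp_neg_quad (hM : M.PosDef) :
    ∫ x : Space n, Real.exp (-(1 / 2) * quad M x)
      = (2 * Real.pi) ^ ((n : ℝ) / 2) / √M.det := by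
  set L := CFC.sqrt M
  have hLL : L * L = M := CFC.sqrt_mul_sqrt_self M hM.posSemidef.nonneg
  have hLt : Lᵀ = L := transpose_eq_of_isHermitian
    (Matrix.nonneg_iff_posSemidef.1 (CFC.sqrt_nonneg M)).isHermitian
  have hdet2 : L.det * L.det = M.det := by rw [← Matrix.det_mul, hLL]
  have hdet : |L.det| = √M.det := by rw [← hdet2, Real.sqrt_mul_self_eq_abs]
  have hL : L.det ≠ 0 := fun h => hM.det_pos.ne' (by rw [← hdet2, h, zero_mul])
  have h1 : ∀ x : Space n, Real.exp (-(1 / 2) * quad M x)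
      = Real.exp (-(1 / 2) * ‖app L x‖ ^ 2) := fun x => by
    rw [← quad_one, quad_app, mul_one, hLt, hLL]
  simp_rw [h1]
  rw [integral_comp_app hL (g := fun x => Real.exp (-(1 / 2) * ‖x‖ ^ 2)) (by fun_prop),
    GaussianFourier.integral_rexp_neg_mul_sq_norm (by norm_num), hdet, finrank_euclideanSpace_fin,
    inv_mul_eq_div]
  congr 2
  ring

/-- Completing the square: this translation absorbs the linear term in the next integral. -/
lemma quad_add_app_inv (hM : M.PosDef) (y b : Space n) :
    quad M (y + app M⁻¹ b) = quad M y + 2 * inner ℝ y b + quad M⁻¹ b := by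
  have hMt := transpose_eq_of_isHermitian hM.isHermitian
  have hb : app M (app M⁻¹ b) = b := by
    rw [← app_mul, Matrix.mul_nonsing_inv _ hM.det_pos.ne'.isUnit, app_one]
  have h1 : inner ℝ (app M⁻¹ b) (app M y) = inner ℝ y b := by
    rw [real_inner_comm, inner_app_left, hMt, hb]
  rw [quad, app_map_add, hb, inner_add_left, inner_add_right, inner_add_right, h1, quad, quad,
    real_inner_comm b (app M⁻¹ b)]
  ring

lemma integral_exp_neg_quad_sub_inner (hM : M.PosDef) (b : Space n) :
    ∫ x : Space n, Real.exp (-(1 / 2) * quad M x - inner ℝ x b)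
      = Real.exp (1 / 2 * quad M⁻¹ b) * ((2 * Real.pi) ^ ((n : ℝ) / 2) / √M.det) := by
  rw [← integral_exp_neg_quad hM, ← integral_const_mul,
    ← integral_add_right_eq_self
      (fun x => Real.exp (1 / 2 * quad M⁻¹ b) * Real.exp (-(1 / 2) * quad M x)) (app M⁻¹ b)]
  congr 1 with x
  rw [← Real.exp_add, quad_add_app_inv hM]
  congr 1
  ring

lemma measurable_gaussian_density (A : Matrix (Fin n) (Fin n) ℝ) (c : ℝ) :
    Measurable fun x : Space n => ENNReal.ofReal (c * Real.exp (-(1 / 2) * quad A x)) :=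
  ((continuous_const.mul (Real.continuous_exp.comp
    (continuous_const.mul (continuous_quad A)))).measurable).ennreal_ofReal

lemma integral_gaussian (A : Matrix (Fin n) (Fin n) ℝ) (g : Space n → ℝ) :
    ∫ y, g y ∂(gaussian A) = √A.det / (2 * Real.pi) ^ ((n : ℝ) / 2) *
      ∫ y, Real.exp (-(1 / 2) * quad A y) * g y := by
  rw [gaussian, integral_withDensity_eq_integral_toReal_smul (measurable_gaussian_density A _)
    (by simp), ← integral_const_mul]
  congr 1 with y
  rw [ENNReal.toReal_ofReal (by positivity), smul_eq_mul, mul_assoc]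

lemma integral_exp_neg_quad_gaussian (hA : A.PosDef) (hB : B.PosSemidef) :
    ∫ y, Real.exp (-(1 / 2) * quad B y) ∂(gaussian A) = √A.det / √(A + B).det := by
  rw [integral_gaussian]
  simp_rw [← Real.exp_add, ← mul_add, ← quad_add]
  rw [integral_exp_neg_quad (hA.add_posSemidef hB)]
  have : (2 * Real.pi) ^ ((n : ℝ) / 2) ≠ 0 := by positivity
  field_simp

lemma tiltDensity_eq (hA : A.PosDef) (hB : B.PosSemidef) (x : Space n) :
    tiltDensity A B x = √(A + B).det / √A.det * Real.exp (-(1 / 2) * quad B x) := by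
  rw [tiltDensity, integral_exp_neg_quad_gaussian hA hB, inv_div]

lemma target_tiltDensity (hA : A.PosDef) (hB : B.PosDef) :
    target A (tiltDensity A B) = gaussian (A + B) := by
  have hm : Measurable fun x : Space n => ENNReal.ofReal (tiltDensity A B x) :=
    measurable_gaussian_density B _
  rw [target, gaussian, gaussian, ← withDensity_mul _ (measurable_gaussian_density A _) hm]
  congr 1 with x
  have := hA.det_pos
  rw [Pi.mul_apply, ← ENNReal.ofReal_mul (by positivity), tiltDensity_eq hA hB.posSemidef,
    quad_add, mul_add, Real.exp_add]
  congr 1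
  field_simp

lemma ae_gaussian_iff (hA : A.PosDef) {p : Space n → Prop} :
    (∀ᵐ x ∂(gaussian A), p x) ↔ ∀ᵐ x, p x := by
  have := hA.det_pos
  rw [gaussian, ae_withDensity_iff (measurable_gaussian_density A _)]
  refine eventually_congr (Eventually.of_forall fun x => ?_)
  have h : ENNReal.ofReal (√A.det / (2 * Real.pi) ^ ((n : ℝ) / 2) *
      Real.exp (-(1 / 2) * quad A x)) ≠ 0 := by
    rw [Ne, ENNReal.ofReal_eq_zero, not_le]
    positivity
  exact ⟨fun hp => hp h, fun hp _ => hp⟩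

/-- Inverting the covariance relation gives the precision relation; `A⁻¹ Lᵀ B` is a right inverse of
`L`. -/
lemma transpose_mul_mul_eq_of_covariance {L : Matrix (Fin n) (Fin n) ℝ} (hA : A.PosDef)
    (hB : B.PosDef) (hL : L * A⁻¹ * Lᵀ = B⁻¹) : IsUnit L.det ∧ Lᵀ * B * L = A := by
  have hLu : IsUnit L.det := Matrix.isUnit_det_of_right_inverse (B := A⁻¹ * Lᵀ * B) <| by
    rw [← mul_assoc, ← mul_assoc, hL, Matrix.nonsing_inv_mul _ hB.det_pos.ne'.isUnit]
  have hLtu : IsUnit Lᵀ.det := by rwa [Matrix.det_transpose]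
  have h1 : A⁻¹ = L⁻¹ * B⁻¹ * Lᵀ⁻¹ := by
    rw [← hL]
    simp only [mul_assoc, Matrix.mul_nonsing_inv _ hLtu, mul_one]
    rw [← mul_assoc, Matrix.nonsing_inv_mul _ hLu, one_mul]
  refine ⟨hLu, ?_⟩
  rw [← Matrix.nonsing_inv_nonsing_inv A hA.det_pos.ne'.isUnit, h1, Matrix.mul_inv_rev,
    Matrix.mul_inv_rev, Matrix.nonsing_inv_nonsing_inv _ hLtu,
    Matrix.nonsing_inv_nonsing_inv _ hLu,
    Matrix.nonsing_inv_nonsing_inv _ hB.det_pos.ne'.isUnit, mul_assoc]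

/-- A linear map sends centred Gaussians to centred Gaussians and transforms the covariance. -/
theorem measurePreserving_app_gaussian {L : Matrix (Fin n) (Fin n) ℝ} (hA : A.PosDef)
    (hB : B.PosDef) (hL : L * A⁻¹ * Lᵀ = B⁻¹) :
    MeasurePreserving (app L) (gaussian A) (gaussian B) := by
  obtain ⟨hLu, hconj⟩ := transpose_mul_mul_eq_of_covariance hA hB hL
  have hL0 : L.det ≠ 0 := hLu.ne_zero
  have hdet : L.det ^ 2 * B.det = A.det := by
    rw [← hconj, Matrix.det_mul, Matrix.det_mul, Matrix.det_transpose]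
    ring
  refine ⟨(continuous_app L).measurable, ?_⟩
  have habs : |L.det| * √B.det = √A.det := by
    rw [← hdet, Real.sqrt_mul (sq_nonneg _), Real.sqrt_sq_eq_abs]
  ext s hs
  rw [Measure.map_apply (continuous_app L).measurable hs, gaussian, gaussian,
    withDensity_apply _ hs, withDensity_apply _ ((continuous_app L).measurable hs)]
  have hvol : (volume : Measure (Space n))
      = ENNReal.ofReal |L.det| • (volume : Measure (Space n)).map (app L) := by
    rw [map_app_volume hL0, smul_smul, ← ENNReal.ofReal_mul (abs_nonneg _), ← abs_mul,
      mul_inv_cancel₀ hL0]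
    simp
  conv_rhs => rw [hvol]
  rw [Measure.restrict_smul, lintegral_smul_measure,
    setLIntegral_map hs (measurable_gaussian_density B _) (continuous_app L).measurable,
    smul_eq_mul, ← lintegral_const_mul' _ _ ENNReal.ofReal_ne_top]
  congr 1 with x
  rw [← ENNReal.ofReal_mul (abs_nonneg _), quad_app, hconj, ← habs]
  congr 1
  ring

end GaussianIntegrals

/-! ### Derivatives and inverses of matrix-valued functions. -/

section MatrixCalculus

variable {N : Matrix (Fin n) (Fin n) ℝ} {t : ℝ}

lemma hasDerivAt_app {X : ℝ → Matrix (Fin n) (Fin n) ℝ} {X' : Matrix (Fin n) (Fin n) ℝ}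
    (h : HasDerivAt X X' t) (x : Space n) : HasDerivAt (fun s => app (X s) x) (app X' x) t := by
  let L : Matrix (Fin n) (Fin n) ℝ →ₗ[ℝ] Space n :=
    (ContinuousLinearMap.apply ℝ (Space n) x).toLinearMap ∘ₗ
      (Matrix.toEuclideanCLM (n := Fin n) (𝕜 := ℝ)).toAlgEquiv.toLinearMap
  exact (LinearMap.toContinuousLinearMap L).hasFDerivAt.comp_hasDerivAt t h

lemma hasDerivAt_transpose {X : ℝ → Matrix (Fin n) (Fin n) ℝ} {X' : Matrix (Fin n) (Fin n) ℝ}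
    (h : HasDerivAt X X' t) : HasDerivAt (fun s => (X s)ᵀ) X'ᵀ t :=
  (LinearMap.toContinuousLinearMap
    (Matrix.transposeLinearEquiv (Fin n) (Fin n) ℝ ℝ).toLinearMap).hasFDerivAt.comp_hasDerivAt t h

lemma hasDerivAt_normSq_app {X : ℝ → Matrix (Fin n) (Fin n) ℝ} {F : Matrix (Fin n) (Fin n) ℝ}
    (h : HasDerivAt X (F * X t) t) (x : Space n) :
    HasDerivAt (fun s => ‖app (X s) x‖ ^ 2) (2 * quad F (app (X t) x)) t := by
  have := (hasDerivAt_app h x).norm_sq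
  rwa [app_mul] at this

lemma continuousAt_matrix_inv (hM : IsUnit M.det) :
    ContinuousAt (fun N : Matrix (Fin n) (Fin n) ℝ => N⁻¹) M := by
  obtain ⟨u, rfl⟩ := (Matrix.isUnit_iff_isUnit_det M).2 hM
  simpa only [Matrix.nonsing_inv_eq_ringInverse] using! NormedRing.inverse_continuousAt u

lemma commute_inv_right (hM : IsUnit M.det) (h : Commute N M) : Commute N M⁻¹ := by
  obtain ⟨u, rfl⟩ := (Matrix.isUnit_iff_isUnit_det M).2 hM
  rw [← Matrix.coe_units_inv]
  exact h.units_inv_right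

end MatrixCalculus

/-! ### The matrices of the Mehler formula. -/

section Decay

variable {t : ℝ}

/-- The matrix `e^{-tA}`. -/
def decay (A : Matrix (Fin n) (Fin n) ℝ) (t : ℝ) : Matrix (Fin n) (Fin n) ℝ :=
  NormedSpace.exp (-t • A)

@[simp] lemma decay_zero (A : Matrix (Fin n) (Fin n) ℝ) : decay A 0 = 1 := by simp [decay]

lemma decay_add (A : Matrix (Fin n) (Fin n) ℝ) (s t : ℝ) :
    decay A (s + t) = decay A s * decay A t := by
  rw [decay, decay, decay, ← Matrix.exp_add_of_commute, neg_add, add_smul]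
  exact ((Commute.refl A).smul_left _).smul_right _

lemma decay_mul_neg (A : Matrix (Fin n) (Fin n) ℝ) (t : ℝ) : decay A t * decay A (-t) = 1 := by
  rw [← decay_add, add_neg_cancel, decay_zero]

lemma decay_neg_mul (A : Matrix (Fin n) (Fin n) ℝ) (t : ℝ) : decay A (-t) * decay A t = 1 := by
  rw [← decay_add, neg_add_cancel, decay_zero]

lemma isUnit_det_decay (A : Matrix (Fin n) (Fin n) ℝ) (t : ℝ) : IsUnit (decay A t).det :=
  Matrix.isUnit_det_of_right_inverse (decay_mul_neg A t)

lemma inv_decay (A : Matrix (Fin n) (Fin n) ℝ) (t : ℝ) : (decay A t)⁻¹ = decay A (-t) :=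
  Matrix.inv_eq_right_inv (decay_mul_neg A t)

lemma transpose_decay (hA : Aᵀ = A) (t : ℝ) : (decay A t)ᵀ = decay A t := by
  rw [decay, ← Matrix.exp_transpose, Matrix.transpose_smul, hA]

lemma commute_decay (A : Matrix (Fin n) (Fin n) ℝ) (t : ℝ) : Commute A (decay A t) :=
  ((Commute.refl A).smul_right _).exp_right

lemma hasDerivAt_decay (A : Matrix (Fin n) (Fin n) ℝ) (t : ℝ) :
    HasDerivAt (decay A) (-A * decay A t) t := by
  have h := (hasDerivAt_exp_smul_const' (𝕂 := ℝ) A (-t)).scomp t (hasDerivAt_neg t)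
  convert! h using 1
  simp [decay]

/-- Grönwall: `e^{2cs} ‖e^{-sA} x‖²` is nonincreasing in `s`. -/
lemma norm_app_decay_le {c : ℝ} (hc : ∀ x, c * ‖x‖ ^ 2 ≤ quad A x) (ht : 0 ≤ t) (x : Space n) :
    ‖app (decay A t) x‖ ≤ Real.exp (-c * t) * ‖x‖ := by
  have hderiv : ∀ s, HasDerivAt (fun s => Real.exp (2 * c * s) * ‖app (decay A s) x‖ ^ 2)
      (Real.exp (2 * c * s) * (2 * c) * ‖app (decay A s) x‖ ^ 2
        + Real.exp (2 * c * s) * (2 * quad (-A) (app (decay A s) x))) s := fun s =>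
    (((hasDerivAt_id s).const_mul (2 * c)).exp.congr_deriv (by simp)).mul
      (hasDerivAt_normSq_app (hasDerivAt_decay A s) x)
  have hanti := antitone_of_hasDerivAt_nonpos hderiv fun s => by
    have h1 := hc (app (decay A s) x)
    have h2 : quad (-A) (app (decay A s) x) = -quad A (app (decay A s) x) := by
      simp [quad, app_neg]
    have h3 := Real.exp_pos (2 * c * s)
    simp only [Pi.zero_apply]
    rw [h2]
    nlinarith
  have h := hanti ht
  simp only [mul_zero, Real.exp_zero, one_mul, decay_zero, app_one] at h
  refine (pow_le_pow_iff_left₀ (norm_nonneg _) (by positivity) two_ne_zero).1 ?_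
  have h4 : (Real.exp (-c * t)) ^ 2 * Real.exp (2 * c * t) = 1 := by
    rw [← Real.exp_nat_mul, ← Real.exp_add, ← Real.exp_zero]
    congr 1
    push_cast
    ring
  calc ‖app (decay A t) x‖ ^ 2
      = (Real.exp (-c * t)) ^ 2 * (Real.exp (2 * c * t) * ‖app (decay A t) x‖ ^ 2) := by
        rw [← mul_assoc, h4, one_mul]
    _ ≤ (Real.exp (-c * t)) ^ 2 * ‖x‖ ^ 2 := by gcongr
    _ = (Real.exp (-c * t) * ‖x‖) ^ 2 := by ring

lemma norm_decay_le {c : ℝ} (hc : ∀ x, c * ‖x‖ ^ 2 ≤ quad A x) (ht : 0 ≤ t) :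
    ‖decay A t‖ ≤ Real.exp (-c * t) :=
  norm_le_of_app _ (Real.exp_pos _).le (norm_app_decay_le hc ht)

/-- The matrix `√(Id - e^{-2tA})`. -/
def spread (A : Matrix (Fin n) (Fin n) ℝ) (t : ℝ) : Matrix (Fin n) (Fin n) ℝ :=
  CFC.sqrt (1 - NormedSpace.exp (-(2 * t) • A))

lemma spread_eq (A : Matrix (Fin n) (Fin n) ℝ) (t : ℝ) :
    spread A t = CFC.sqrt (1 - decay A t * decay A t) := by
  rw [← decay_add, ← two_mul]
  rfl

lemma transpose_spread (A : Matrix (Fin n) (Fin n) ℝ) (t : ℝ) : (spread A t)ᵀ = spread A t :=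
  transpose_eq_of_isHermitian (Matrix.nonneg_iff_posSemidef.1 (CFC.sqrt_nonneg _)).isHermitian

lemma spread_mul_spread (hA : A.PosDef) (ht : 0 ≤ t) :
    spread A t * spread A t = 1 - decay A t * decay A t := by
  rw [spread_eq]
  -- The square root is genuine only for a positive semidefinite argument, which here means that
  -- `e^{-tA}` is a contraction; this is where `0 ≤ t` enters.
  refine CFC.sqrt_mul_sqrt_self _ (Matrix.nonneg_iff_posSemidef.2 ?_)
  have hE := transpose_decay (transpose_eq_of_isHermitian hA.isHermitian) t
  refine posSemidef_of_quad ?_ fun x => ?_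
  · rw [Matrix.transpose_sub, Matrix.transpose_mul, hE, Matrix.transpose_one]
  · have h1 : quad (decay A t * decay A t) x = ‖app (decay A t) x‖ ^ 2 := by
      rw [← quad_one, quad_app, mul_one, hE]
    have h2 : ‖app (decay A t) x‖ ≤ ‖x‖ := by
      simpa using norm_app_decay_le (c := 0) (by simpa using quad_nonneg hA.posSemidef) ht x
    rw [quad_sub, quad_one, h1, sub_nonneg]
    gcongr

lemma commute_spread (A : Matrix (Fin n) (Fin n) ℝ) (t : ℝ) : Commute (spread A t) A := by
  rw [spread_eq, CFC.sqrt]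
  refine Commute.cfcₙ_nnreal ?_ _
  have h := (commute_decay A t).symm
  exact (Commute.one_left A).sub_left (h.mul_left h)

/-- The covariance of the noise term in the Mehler formula. Both factors commute with `A`, so only
the squares matter. -/
lemma spread_mul_inv_mul_spread (hA : A.PosDef) (ht : 0 ≤ t) :
    spread A t * A⁻¹ * spread A t = A⁻¹ - decay A t * A⁻¹ * decay A t := by
  have hu : IsUnit A.det := hA.det_pos.ne'.isUnit
  have h1 := commute_inv_right hu (commute_spread A t)
  have h2 := commute_inv_right hu (commute_decay A t).symm
  rw [h1.eq, h2.eq, mul_assoc, mul_assoc, spread_mul_spread hA ht, mul_sub, mul_one]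

end Decay

/-! ### The evolution of the tilt `B` under the heat flow. -/

section Evolved

variable {s t : ℝ}

/-- The matrix `B_t` with `P_t^A f_{A,B} = f_{A,B_t}`. -/
def evolved (A B : Matrix (Fin n) (Fin n) ℝ) (t : ℝ) : Matrix (Fin n) (Fin n) ℝ :=
  (decay A (-t) * (A⁻¹ + B⁻¹) * decay A (-t) - A⁻¹)⁻¹

/-- The definition displays the semigroup law; this form displays positivity and exponential decay.
-/
lemma evolved_eq (hA : A.PosDef) (ht : 0 ≤ t) :
    evolved A B t
      = decay A t * (B⁻¹ + spread A t * A⁻¹ * spread A t)⁻¹ * decay A t := by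
  have h : decay A (-t) * (A⁻¹ + B⁻¹) * decay A (-t) - A⁻¹
      = decay A (-t) * (B⁻¹ + spread A t * A⁻¹ * spread A t) * decay A (-t) := by
    have h1 : decay A (-t) * (decay A t * A⁻¹ * decay A t) * decay A (-t) = A⁻¹ := by
      rw [← mul_assoc, ← mul_assoc, decay_neg_mul, one_mul, mul_assoc, decay_mul_neg, mul_one]
    rw [spread_mul_inv_mul_spread hA ht]
    simp only [mul_add, add_mul, mul_sub, sub_mul, h1]
    abel
  rw [evolved, h, Matrix.mul_inv_rev, Matrix.mul_inv_rev, inv_decay, neg_neg, ← mul_assoc]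

lemma posDef_inv_add_spread (hA : A.PosDef) (hB : B.PosDef) (t : ℝ) :
    (B⁻¹ + spread A t * A⁻¹ * spread A t).PosDef := by
  refine hB.inv.add_posSemidef ?_
  have := hA.inv.posSemidef.mul_mul_conjTranspose_same (spread A t)
  rwa [Matrix.conjTranspose_eq_transpose_of_trivial, transpose_spread] at this

lemma posDef_evolved (hA : A.PosDef) (hB : B.PosDef) (ht : 0 ≤ t) : (evolved A B t).PosDef := by
  rw [evolved_eq hA ht]
  have := (posDef_inv_add_spread hA hB t).inv.mul_mul_conjTranspose_same (B := decay A t)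
    (Matrix.vecMul_injective_of_isUnit ((Matrix.isUnit_iff_isUnit_det _).2 (isUnit_det_decay A t)))
  rwa [Matrix.conjTranspose_eq_transpose_of_trivial,
    transpose_decay (transpose_eq_of_isHermitian hA.isHermitian)] at this

lemma evolved_zero (hB : B.PosDef) : evolved A B 0 = B := by
  rw [evolved, neg_zero, decay_zero, one_mul, mul_one, add_sub_cancel_left,
    Matrix.nonsing_inv_nonsing_inv _ hB.det_pos.ne'.isUnit]

lemma isUnit_det_inv_evolved (hA : A.PosDef) (hB : B.PosDef) (ht : 0 ≤ t) :
    IsUnit (decay A (-t) * (A⁻¹ + B⁻¹) * decay A (-t) - A⁻¹).det :=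
  (Matrix.isUnit_nonsing_inv_det_iff).1 (posDef_evolved hA hB ht).det_pos.ne'.isUnit

lemma inv_evolved (hA : A.PosDef) (hB : B.PosDef) (ht : 0 ≤ t) :
    (evolved A B t)⁻¹ = decay A (-t) * (A⁻¹ + B⁻¹) * decay A (-t) - A⁻¹ :=
  Matrix.nonsing_inv_nonsing_inv _ (isUnit_det_inv_evolved hA hB ht)

/-- `A⁻¹ + B_t⁻¹` evolves by conjugation with the one-parameter group `e^{tA}`. -/
lemma evolved_evolved (hA : A.PosDef) (hB : B.PosDef) (hs : 0 ≤ s) (t : ℝ) :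
    evolved A (evolved A B s) t = evolved A B (s + t) := by
  rw [evolved, inv_evolved hA hB hs, add_sub_cancel, evolved, neg_add, decay_add]
  congr 2
  have hc : decay A (-s) * decay A (-t) = decay A (-t) * decay A (-s) := by
    rw [← decay_add, add_comm, decay_add]
  nth_rewrite 1 [hc]
  simp only [mul_assoc]

lemma commute_of_commute_evolved (hA : A.PosDef) (hB : B.PosDef) (ht : 0 ≤ t)
    (h : Commute A (evolved A B t)) : Commute A B := by
  have hAu : IsUnit A.det := hA.det_pos.ne'.isUnit
  have h1 := commute_inv_right (posDef_evolved hA hB ht).det_pos.ne'.isUnit h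
  rw [inv_evolved hA hB ht] at h1
  have hAi := commute_inv_right hAu (Commute.refl A)
  have h2 : Commute A (decay A (-t) * (A⁻¹ + B⁻¹) * decay A (-t)) := by
    simpa using h1.add_right hAi
  have h3 := ((commute_decay A t).mul_right h2).mul_right (commute_decay A t)
  have h4 : decay A t * (decay A (-t) * (A⁻¹ + B⁻¹) * decay A (-t)) * decay A t = A⁻¹ + B⁻¹ := by
    rw [← mul_assoc, ← mul_assoc, decay_mul_neg, one_mul, mul_assoc, decay_neg_mul, mul_one]
  rw [h4] at h3
  have h5 : Commute A B⁻¹ := by simpa using h3.sub_right hAi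
  have h6 := commute_inv_right hB.inv.det_pos.ne'.isUnit h5
  rwa [Matrix.nonsing_inv_nonsing_inv _ hB.det_pos.ne'.isUnit] at h6

/-- In `evolved_eq` the middle inverse is bounded because its argument dominates `B⁻¹`, and each
outer factor decays like `e^{-at}`. -/
lemma exists_norm_evolved_le (hA : A.PosDef) (hB : B.PosDef) :
    ∃ K, ∃ c > 0, ∀ t, 0 ≤ t → ‖evolved A B t‖ ≤ K * Real.exp (-c * t) := by
  obtain ⟨b, hb, hbq⟩ := exists_quad_lower_bound hB.inv
  obtain ⟨a, ha, haq⟩ := exists_quad_lower_bound hA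
  refine ⟨b⁻¹, 2 * a, by positivity, fun t ht => ?_⟩
  have hN : ‖(B⁻¹ + spread A t * A⁻¹ * spread A t)⁻¹‖ ≤ b⁻¹ := by
    refine norm_inv_le_of_quad_lower_bound hb
      (posDef_inv_add_spread hA hB t).det_pos.ne'.isUnit fun x => ?_
    have h := hA.inv.posSemidef.mul_mul_conjTranspose_same (spread A t)
    rw [Matrix.conjTranspose_eq_transpose_of_trivial, transpose_spread] at h
    rw [quad_add]
    linarith [hbq x, quad_nonneg h x]
  have hE := norm_decay_le haq ht
  rw [evolved_eq hA ht]
  calc _ ≤ ‖decay A t‖ * ‖(B⁻¹ + spread A t * A⁻¹ * spread A t)⁻¹‖ * ‖decay A t‖ :=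
        (norm_mul_le _ _).trans (by gcongr; exact norm_mul_le _ _)
    _ ≤ Real.exp (-a * t) * b⁻¹ * Real.exp (-a * t) := by gcongr
    _ = b⁻¹ * Real.exp (-(2 * a) * t) := by
        rw [mul_right_comm, ← Real.exp_add, mul_comm]
        congr 2
        ring

/-- Negative times are frozen at `0`, since there the matrix inverted in `evolved` may be singular,
while the linear equation is solved on all of `ℝ`. -/
lemma continuous_evolved_max (hA : A.PosDef) (hB : B.PosDef) :
    Continuous fun t => evolved A B (max t 0) := by
  rw [continuous_iff_continuousAt]
  intro t
  have hd : Continuous (decay A) :=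
    continuous_iff_continuousAt.2 fun s => (hasDerivAt_decay A s).continuousAt
  have hW : Continuous fun t : ℝ =>
      decay A (-max t 0) * (A⁻¹ + B⁻¹) * decay A (-max t 0) - A⁻¹ := by fun_prop
  exact (continuousAt_matrix_inv (isUnit_det_inv_evolved hA hB (le_max_right t 0))).comp
    (f := fun t : ℝ => decay A (-max t 0) * (A⁻¹ + B⁻¹) * decay A (-max t 0) - A⁻¹)
    hW.continuousAt

end Evolved

/-! ### The covariance along the heat flow and its differential equation. -/

section Covariance

variable {t : ℝ}

/-- The covariance matrix `(A + B_t)⁻¹`, in a form that is defined and smooth for all times. -/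
def covariance (A B : Matrix (Fin n) (Fin n) ℝ) (t : ℝ) : Matrix (Fin n) (Fin n) ℝ :=
  A⁻¹ - A⁻¹ * (decay A t * (A⁻¹ + B⁻¹)⁻¹ * decay A t) * A⁻¹

lemma transpose_covariance (hA : A.PosDef) (hB : B.PosDef) (t : ℝ) :
    (covariance A B t)ᵀ = covariance A B t := by
  have h1 := transpose_eq_of_isHermitian hA.inv.isHermitian
  have h2 := transpose_eq_of_isHermitian (hA.inv.add hB.inv).inv.isHermitian
  have h3 := transpose_decay (transpose_eq_of_isHermitian hA.isHermitian) t
  simp only [covariance, Matrix.transpose_sub, Matrix.transpose_mul, h1, h2, h3, mul_assoc]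

/-- With `D = A⁻¹ + B_t⁻¹`, the covariance factors as `(D - A⁻¹) D⁻¹ A⁻¹`, and `B_t` cancels the
first factor. -/
lemma evolved_mul_covariance (hA : A.PosDef) (hB : B.PosDef) (ht : 0 ≤ t) :
    evolved A B t * covariance A B t = 1 - A * covariance A B t := by
  have hAu : IsUnit A.det := hA.det_pos.ne'.isUnit
  have hCu : IsUnit (A⁻¹ + B⁻¹).det := (hA.inv.add hB.inv).det_pos.ne'.isUnit
  set D := decay A (-t) * (A⁻¹ + B⁻¹) * decay A (-t)
  set D' := decay A t * (A⁻¹ + B⁻¹)⁻¹ * decay A t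
  have hD : D * D' = 1 := by
    simp only [D, D', mul_assoc]
    rw [← mul_assoc (decay A (-t)) (decay A t), decay_neg_mul, one_mul,
      Matrix.mul_nonsing_inv_cancel_left _ _ hCu, decay_neg_mul]
  have hV : covariance A B t = (D - A⁻¹) * (D' * A⁻¹) := by
    rw [sub_mul, ← mul_assoc, hD, one_mul, ← mul_assoc]
    rfl
  have h1 : evolved A B t * covariance A B t = D' * A⁻¹ := by
    rw [hV, ← mul_assoc]
    change (D - A⁻¹)⁻¹ * (D - A⁻¹) * _ = _
    rw [Matrix.nonsing_inv_mul _ (isUnit_det_inv_evolved hA hB ht), one_mul]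
  have h2 : A * covariance A B t = 1 - D' * A⁻¹ := by
    change A * (A⁻¹ - A⁻¹ * D' * A⁻¹) = _
    rw [mul_sub, mul_assoc A⁻¹, Matrix.mul_nonsing_inv_cancel_left _ _ hAu,
      Matrix.mul_nonsing_inv _ hAu]
  rw [h1, h2, sub_sub_cancel]

lemma covariance_mul_evolved (hA : A.PosDef) (hB : B.PosDef) (ht : 0 ≤ t) :
    covariance A B t * evolved A B t = 1 - covariance A B t * A := by
  have := congrArg Matrix.transpose (evolved_mul_covariance hA hB ht)
  simpa [transpose_covariance hA hB, transpose_eq_of_isHermitian hA.isHermitian,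
    transpose_eq_of_isHermitian (posDef_evolved hA hB ht).isHermitian] using this

lemma covariance_zero (hA : A.PosDef) (hB : B.PosDef) : covariance A B 0 = (A + B)⁻¹ := by
  have h := evolved_mul_covariance hA hB le_rfl
  rw [evolved_zero hB] at h
  exact (Matrix.inv_eq_right_inv (by rw [add_mul, h, add_sub_cancel])).symm

/-- For `t ≥ 0` and positive definite `B` the right side is `B_t V + V B_t`, with `V` the
covariance; this is what makes `R V Rᵀ` constant. -/
lemma hasDerivAt_covariance (hA : A.PosDef) (t : ℝ) :
    HasDerivAt (covariance A B)
      ((1 - A * covariance A B t) + (1 - covariance A B t * A)) t := by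
  have hAu : IsUnit A.det := hA.det_pos.ne'.isUnit
  have hd := hasDerivAt_decay A t
  have h := (((((hd.mul_const (A⁻¹ + B⁻¹)⁻¹).mul hd).const_mul A⁻¹).mul_const A⁻¹).const_sub A⁻¹)
  refine h.congr_deriv ?_
  rw [neg_mul, (commute_decay A t).eq]
  simp only [covariance, mul_sub, sub_mul, mul_add, add_mul, neg_mul, mul_neg, mul_assoc,
    Matrix.mul_nonsing_inv_cancel_left _ _ hAu, Matrix.mul_nonsing_inv _ hAu,
    Matrix.nonsing_inv_mul _ hAu, mul_one]
  rw [← mul_assoc (decay A t) A, ← (commute_decay A t).eq, mul_assoc,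
    Matrix.nonsing_inv_mul_cancel_left _ _ hAu]
  abel

lemma tendsto_covariance (hA : A.PosDef) :
    Tendsto (covariance A B) atTop (𝓝 A⁻¹) := by
  obtain ⟨a, ha, haq⟩ := exists_quad_lower_bound hA
  have hE : Tendsto (decay A) atTop (𝓝 0) := by
    refine squeeze_zero_norm' ((eventually_ge_atTop 0).mono fun t ht => norm_decay_le haq ht) ?_
    have : Tendsto (fun t : ℝ => a * t) atTop atTop := tendsto_id.const_mul_atTop ha
    simpa [Function.comp_def] using Real.tendsto_exp_neg_atTop_nhds_zero.comp this
  have h := ((((hE.mul_const (A⁻¹ + B⁻¹)⁻¹).mul hE).const_mul A⁻¹).mul_const A⁻¹).const_sub A⁻¹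
  simpa using! h

end Covariance

/-! ### The linear flow, its inverse and the limit. -/

section Propagator

variable {t : ℝ}

/-- `Φ` solves `Φ' = B_t Φ`, `Φ_0 = 1`, `R` is its inverse, and `R_t` converges to `T`. -/
structure IsPropagator (A B : Matrix (Fin n) (Fin n) ℝ) (Φ R : ℝ → Matrix (Fin n) (Fin n) ℝ)
    (T : Matrix (Fin n) (Fin n) ℝ) : Prop where
  zero : Φ 0 = 1
  deriv : ∀ t, HasDerivAt Φ (evolved A B (max t 0) * Φ t) t
  deriv_inv : ∀ t, HasDerivAt R (-(R t * evolved A B (max t 0))) t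
  inv_mul : ∀ t, R t * Φ t = 1
  tendsto : Tendsto R atTop (𝓝 T)

variable {Φ R : ℝ → Matrix (Fin n) (Fin n) ℝ} {T : Matrix (Fin n) (Fin n) ℝ}

lemma IsPropagator.mul_inv (h : IsPropagator A B Φ R T) (t : ℝ) : Φ t * R t = 1 :=
  mul_eq_one_comm.1 (h.inv_mul t)

lemma IsPropagator.inv_zero (h : IsPropagator A B Φ R T) : R 0 = 1 := by
  simpa [h.zero] using h.inv_mul 0

/-- `‖Φ_t x‖²` has derivative `2 quad B_t (Φ_t x) ≥ 0`. This expansion is the source of the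
`1`-Lipschitz bound. -/
lemma norm_le_norm_app (hA : A.PosDef) (hB : B.PosDef) (h0 : Φ 0 = 1)
    (h : ∀ t, HasDerivAt Φ (evolved A B (max t 0) * Φ t) t) (ht : 0 ≤ t) (x : Space n) :
    ‖x‖ ≤ ‖app (Φ t) x‖ := by
  have hmono := monotone_of_hasDerivAt_nonneg (fun s => hasDerivAt_normSq_app (h s) x) fun s => by
    have := quad_nonneg (posDef_evolved hA hB (le_max_right s 0)).posSemidef (app (Φ s) x)
    simpa using this
  have := hmono ht
  simp only [h0, app_one] at this
  exact (pow_le_pow_iff_left₀ (norm_nonneg _) (norm_nonneg _) two_ne_zero).1 this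

lemma norm_le_one_of_mul_eq_one (hA : A.PosDef) (hB : B.PosDef) (h0 : Φ 0 = 1)
    (h : ∀ t, HasDerivAt Φ (evolved A B (max t 0) * Φ t) t) (ht : 0 ≤ t) (hR : Φ t * R t = 1) :
    ‖R t‖ ≤ 1 := by
  refine norm_le_of_app _ zero_le_one fun x => ?_
  rw [one_mul]
  simpa [← app_mul, hR] using norm_le_norm_app hA hB h0 h ht (app (R t) x)

theorem exists_isPropagator (hA : A.PosDef) (hB : B.PosDef) :
    ∃ Φ R T, IsPropagator A B Φ R T := by
  obtain ⟨K, c, hc, hK⟩ := exists_norm_evolved_le hA hB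
  have hF := continuous_evolved_max hA hB
  have hK0 : 0 ≤ K := (norm_nonneg _).trans (by simpa using hK 0 le_rfl)
  have hFK : ∀ t, ‖evolved A B (max t 0)‖ ≤ K := fun t => by
    refine (hK _ (le_max_right t 0)).trans (mul_le_of_le_one_right hK0 ?_)
    rw [Real.exp_le_one_iff, neg_mul, neg_nonpos]
    positivity
  obtain ⟨Φ, hΦ0, hΦ⟩ := exists_linear_ode_solution hF hFK
  -- The inverse is built as the transpose of the solution of the adjoint equation `Y' = -B_t Y`, so
  -- no inverse has to be differentiated.
  obtain ⟨Y, hY0, hY⟩ := exists_linear_ode_solution hF.neg (K := K)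
    (fun t => by simpa using hFK t)
  have hR : ∀ t, HasDerivAt (fun s => (Y s)ᵀ) (-((Y t)ᵀ * evolved A B (max t 0))) t := fun t => by
    refine (hasDerivAt_transpose (hY t)).congr_deriv ?_
    have := transpose_eq_of_isHermitian (posDef_evolved hA hB (le_max_right t 0)).isHermitian
    simp [this]
  have hRΦ : ∀ t, (Y t)ᵀ * Φ t = 1 := fun t => by
    have hd : ∀ s, HasDerivAt (fun s => (Y s)ᵀ * Φ s) 0 s := fun s =>
      ((hR s).mul (hΦ s)).congr_deriv (by noncomm_ring)
    have := is_const_of_deriv_eq_zero (fun s => (hd s).differentiableAt)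
      (fun s => (hd s).deriv) t 0
    simpa [hΦ0, hY0] using this
  -- An integrable derivative forces convergence at infinity: `R_t` is a contraction and `B_t`
  -- decays exponentially.
  have hint : IntegrableOn (fun t => -((Y t)ᵀ * evolved A B (max t 0))) (Set.Ioi 0) := by
    have hYc : Continuous fun t => (Y t)ᵀ :=
      continuous_iff_continuousAt.2 fun t => (hR t).continuousAt
    have hg : IntegrableOn (fun t => K * Real.exp (-c * t)) (Set.Ioi 0) :=
      (integrableOn_exp_mul_Ioi (neg_neg_of_pos hc) 0).const_mul K
    refine Integrable.mono' hg (hYc.mul hF).neg.aestronglyMeasurable ?_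
    refine (ae_restrict_mem measurableSet_Ioi).mono fun t ht => ?_
    have ht0 : (0 : ℝ) ≤ t := le_of_lt ht
    have h1 : ‖(Y t)ᵀ‖ ≤ 1 :=
      norm_le_one_of_mul_eq_one (R := fun s => (Y s)ᵀ) hA hB hΦ0 hΦ ht0
        (mul_eq_one_comm.1 (hRΦ t))
    have h2 := hK t ht0
    rw [norm_neg, max_eq_left ht0]
    calc _ ≤ ‖(Y t)ᵀ‖ * ‖evolved A B t‖ := norm_mul_le _ _
      _ ≤ 1 * (K * Real.exp (-c * t)) := by gcongr
      _ = _ := one_mul _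
  exact ⟨Φ, fun s => (Y s)ᵀ, _, hΦ0, hΦ, hR, hRΦ,
    tendsto_limUnder_of_hasDerivAt_of_integrableOn_Ioi (fun t _ => hR t) hint⟩

lemma IsPropagator.norm_limit_le (h : IsPropagator A B Φ R T) (hA : A.PosDef) (hB : B.PosDef) :
    ‖T‖ ≤ 1 :=
  le_of_tendsto h.tendsto.norm ((eventually_ge_atTop 0).mono fun t ht =>
    norm_le_one_of_mul_eq_one hA hB h.zero h.deriv ht (h.mul_inv t))

/-- `R_t V_t R_tᵀ` is conserved, with `V_t` the covariance at time `t`; it is compared at time `0`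
and at infinity. -/
lemma IsPropagator.limit_mul_inv_mul_transpose (h : IsPropagator A B Φ R T) (hA : A.PosDef)
    (hB : B.PosDef) : T * A⁻¹ * Tᵀ = (A + B)⁻¹ := by
  have hd : ∀ t, 0 ≤ t → HasDerivAt (fun s => R s * covariance A B s * (R s)ᵀ) 0 t := by
    intro t ht
    have hB' := transpose_eq_of_isHermitian (posDef_evolved hA hB ht).isHermitian
    have h1 := h.deriv_inv t
    rw [max_eq_left ht] at h1
    refine ((h1.mul (hasDerivAt_covariance (B := B) hA t)).mul
      (hasDerivAt_transpose h1)).congr_deriv ?_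
    rw [← evolved_mul_covariance hA hB ht, ← covariance_mul_evolved hA hB ht]
    rw [Matrix.transpose_neg, Matrix.transpose_mul, hB', Pi.mul_apply]
    noncomm_ring
  have hconst : ∀ t, 0 ≤ t → R t * covariance A B t * (R t)ᵀ = (A + B)⁻¹ := by
    intro t ht
    have := constant_of_has_deriv_right_zero (a := 0) (b := t)
      (f := fun s => R s * covariance A B s * (R s)ᵀ)
      (fun s hs => (hd s hs.1).continuousAt.continuousWithinAt)
      (fun s hs => (hd s hs.1).hasDerivWithinAt) t ⟨ht, le_rfl⟩
    simpa [h.inv_zero, covariance_zero hA hB] using this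
  have htr : Tendsto (fun t => (R t)ᵀ) atTop (𝓝 Tᵀ) :=
    ((continuous_id.matrix_transpose).tendsto T).comp h.tendsto
  have hlim := (h.tendsto.mul (tendsto_covariance (B := B) hA)).mul htr
  exact tendsto_nhds_unique hlim
    (tendsto_const_nhds.congr' ((eventually_ge_atTop 0).mono fun t ht => (hconst t ht).symm))

end Propagator

/-! ### The heat flow of Gaussian densities and the velocity field. -/

section HeatFlow

variable {t : ℝ}

lemma posDef_add_spread (hA : A.PosDef) (hB : B.PosDef) (t : ℝ) :
    (A + spread A t * B * spread A t).PosDef := by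
  refine hA.add_posSemidef ?_
  have := hB.posSemidef.mul_mul_conjTranspose_same (spread A t)
  rwa [Matrix.conjTranspose_eq_transpose_of_trivial, transpose_spread] at this

/-- Completing the square in the Mehler integral produces the left side, whereas `evolved_eq` uses
the right one. -/
lemma woodbury (hA : A.PosDef) (hB : B.PosDef) (t : ℝ) :
    B - B * spread A t * (A + spread A t * B * spread A t)⁻¹ * spread A t * B
      = (B⁻¹ + spread A t * A⁻¹ * spread A t)⁻¹ := by
  have hAu : IsUnit A.det := hA.det_pos.ne'.isUnit
  have hBu : IsUnit B.det := hB.det_pos.ne'.isUnit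
  set σ := spread A t
  set M := A + σ * B * σ with hM
  have hMu : IsUnit M.det := (posDef_add_spread hA hB t).det_pos.ne'.isUnit
  have h1 : M⁻¹ * (σ * B * σ) * A⁻¹ = A⁻¹ - M⁻¹ := by
    have : σ * B * σ = M - A := by rw [hM, add_sub_cancel_left]
    rw [this, mul_sub, sub_mul, Matrix.nonsing_inv_mul _ hMu, one_mul, mul_assoc,
      Matrix.mul_nonsing_inv _ hAu, mul_one]
  refine (Matrix.inv_eq_left_inv ?_).symm
  have h2 : B * σ * M⁻¹ * σ * B * B⁻¹ = B * σ * M⁻¹ * σ := by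
    rw [mul_assoc, Matrix.mul_nonsing_inv _ hBu, mul_one]
  calc (B - B * σ * M⁻¹ * σ * B) * (B⁻¹ + σ * A⁻¹ * σ)
      = B * B⁻¹ + B * σ * A⁻¹ * σ - B * σ * M⁻¹ * σ * B * B⁻¹
          - B * σ * (M⁻¹ * (σ * B * σ) * A⁻¹) * σ := by noncomm_ring
    _ = 1 := by
      rw [h1, h2, Matrix.mul_nonsing_inv _ hBu]
      noncomm_ring

/-- Matches the normalizing constants before and after the flow, by the matrix determinant lemma
applied to both factors on the right. -/
lemma det_add_evolved (hA : A.PosDef) (hB : B.PosDef) (ht : 0 ≤ t) :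
    (A + B).det * A.det
      = (A + evolved A B t).det * (A + spread A t * B * spread A t).det := by
  have hAu : IsUnit A.det := hA.det_pos.ne'.isUnit
  have hBu : IsUnit B.det := hB.det_pos.ne'.isUnit
  have hG := posDef_inv_add_spread hA hB t
  set G := B⁻¹ + spread A t * A⁻¹ * spread A t with hGdef
  have hGu : IsUnit G.det := hG.det_pos.ne'.isUnit
  have h1 : (A + spread A t * B * spread A t).det = A.det * (B.det * G.det) := by
    rw [mul_assoc (spread A t), Matrix.det_add_mul _ _ hAu, ← Matrix.det_mul B]
    congr 2
    rw [hGdef, mul_add, Matrix.mul_nonsing_inv _ hBu]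
    simp only [mul_assoc]
  have h2 : (A + evolved A B t).det = A.det * (G⁻¹.det * (A⁻¹ + B⁻¹).det) := by
    rw [evolved_eq hA ht, ← hGdef, mul_assoc (decay A t), Matrix.det_add_mul _ _ hAu,
      ← Matrix.det_mul G⁻¹]
    congr 2
    have : A⁻¹ + B⁻¹ = G + decay A t * A⁻¹ * decay A t := by
      rw [hGdef, spread_mul_inv_mul_spread hA ht]
      abel
    rw [this, mul_add, Matrix.nonsing_inv_mul _ hGu]
    simp only [mul_assoc]
  have h3 : (A + B).det = A.det * (A⁻¹ + B⁻¹).det * B.det := by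
    rw [← Matrix.det_mul, ← Matrix.det_mul, mul_add, add_mul, Matrix.mul_nonsing_inv _ hAu,
      one_mul, mul_assoc A, Matrix.nonsing_inv_mul _ hBu, mul_one, add_comm]
  have h4 : G⁻¹.det * G.det = 1 := by
    rw [← Matrix.det_mul, Matrix.nonsing_inv_mul _ hGu, Matrix.det_one]
  rw [h1, h2, h3]
  linear_combination (-(A.det ^ 2 * B.det * (A⁻¹ + B⁻¹).det)) * h4

/-- The heat flow maps Gaussian densities to Gaussian densities. -/
theorem heatFlow_tiltDensity (hA : A.PosDef) (hB : B.PosDef) (ht : 0 ≤ t) :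
    heatFlow A t (tiltDensity A B) = tiltDensity A (evolved A B t) := by
  have hAd := hA.det_pos
  have hBt := transpose_eq_of_isHermitian hB.isHermitian
  have hσt := transpose_spread A t
  have hEt := transpose_decay (transpose_eq_of_isHermitian hA.isHermitian) t
  have hM := posDef_add_spread hA hB t
  have hMd := hM.det_pos
  have hdet := det_add_evolved hA hB ht
  have hevol : evolved A B t = decay A t * (B - B * spread A t *
      (A + spread A t * B * spread A t)⁻¹ * spread A t * B) * decay A t := by
    rw [woodbury hA hB, evolved_eq hA ht]
  have hE' := posDef_evolved hA hB ht
  have hABd := (hA.add hB).det_pos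
  have hABtd := (hA.add hE').det_pos
  ext x
  rw [tiltDensity_eq hA hE'.posSemidef, heatFlow, integral_gaussian]
  change _ * ∫ y, Real.exp (-(1 / 2) * quad A y) *
    tiltDensity A B (app (decay A t) x + app (spread A t) y) = _
  set m := app (decay A t) x
  set σ := spread A t
  set M := A + σ * B * σ
  have hquad : ∀ y, quad B (m + app σ y)
      = quad B m + quad (σ * B * σ) y + 2 * inner ℝ y (app (σ * B) m) := by
    intro y
    have h1 : inner ℝ m (app B (app σ y)) = inner ℝ y (app (σ * B) m) := by
      rw [real_inner_comm, ← app_mul, inner_app_left, Matrix.transpose_mul, hBt, hσt]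
    have h2 : inner ℝ (app σ y) (app B m) = inner ℝ y (app (σ * B) m) := by
      rw [inner_app_left, hσt, app_mul]
    have h3 : inner ℝ (app σ y) (app B (app σ y)) = quad (σ * B * σ) y := by
      rw [← quad, quad_app, hσt]
    rw [quad, app_map_add, inner_add_left, inner_add_right, inner_add_right, h1, h2, h3]
    simp only [quad]
    ring
  have hint : ∀ y, Real.exp (-(1 / 2) * quad A y) * tiltDensity A B (m + app σ y)
      = √(A + B).det / √A.det * Real.exp (-(1 / 2) * quad B m) *
        Real.exp (-(1 / 2) * quad M y - inner ℝ y (app (σ * B) m)) := by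
    intro y
    rw [tiltDensity_eq hA hB.posSemidef, hquad, mul_left_comm, ← Real.exp_add,
      mul_assoc (√(A + B).det / √A.det), ← Real.exp_add, quad_add]
    congr 2
    ring
  simp_rw [hint]
  rw [integral_const_mul, integral_exp_neg_quad_sub_inner hM]
  have hexp : Real.exp (-(1 / 2) * quad B m) * Real.exp (1 / 2 * quad M⁻¹ (app (σ * B) m))
      = Real.exp (-(1 / 2) * quad (evolved A B t) x) := by
    have h1 : quad (evolved A B t) x
        = quad (B - B * σ * M⁻¹ * σ * B) m := by
      rw [quad_app, hEt, hevol]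
    rw [h1, quad_sub, quad_app M⁻¹, Matrix.transpose_mul, hBt, hσt, ← Real.exp_add]
    simp only [mul_assoc]
    congr 1
    ring
  have hconst : √(A + B).det / √M.det = √(A + evolved A B t).det / √A.det := by
    rw [← Real.sqrt_div hABd.le, ← Real.sqrt_div hABtd.le]
    congr 1
    rw [div_eq_div_iff hMd.ne' hAd.ne']
    exact hdet
  rw [← hconst, ← hexp]
  have : (2 * Real.pi) ^ ((n : ℝ) / 2) ≠ 0 := by positivity
  have : √A.det ≠ 0 := by positivity
  field_simp

lemma hasGradientAt_half_quad (hM : Mᵀ = M) (x : Space n) :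
    HasGradientAt (fun x => 1 / 2 * quad M x) (app M x) x := by
  have h1 : HasFDerivAt (app M) (Matrix.toEuclideanCLM (n := Fin n) (𝕜 := ℝ) M) x :=
    (Matrix.toEuclideanCLM (n := Fin n) (𝕜 := ℝ) M).hasFDerivAt
  have h2 := ((hasFDerivAt_id x).inner ℝ h1).const_mul (1 / 2)
  rw [hasGradientAt_iff_hasFDerivAt]
  refine h2.congr_fderiv ?_
  ext v
  have h3 : inner ℝ x (app M v) = inner ℝ (app M x) v := by rw [inner_app_left, hM]
  have h4 : inner ℝ v (app M x) = inner ℝ (app M x) v := real_inner_comm _ _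
  simp only [smul_apply, ContinuousLinearMap.comp_apply,
    ContinuousLinearMap.prod_apply, fderivInnerCLM_apply, ContinuousLinearMap.id_apply, id,
    InnerProductSpace.toDual_apply_apply, smul_eq_mul]
  change 1 / 2 * (inner ℝ x (app M v) + inner ℝ v (app M x)) = _
  rw [h3, h4]
  ring

lemma velocity_tiltDensity (hA : A.PosDef) (hB : B.PosDef) (ht : 0 ≤ t) (x : Space n) :
    velocity A (tiltDensity A B) t x = app (evolved A B t) x := by
  have hE := posDef_evolved hA hB ht
  have hd := (hA.add hE).det_pos
  have hAd := hA.det_pos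
  have hlog : (fun z => Real.log (heatFlow A t (tiltDensity A B) z))
      = fun z => Real.log (√(A + evolved A B t).det / √A.det)
        + -(1 / 2 * quad (evolved A B t) z) := by
    ext z
    rw [heatFlow_tiltDensity hA hB ht, tiltDensity_eq hA hE.posSemidef,
      Real.log_mul (by positivity) (Real.exp_pos _).ne', Real.log_exp, neg_mul]
  have hg := hasGradientAt_half_quad (transpose_eq_of_isHermitian hE.isHermitian) x
  have : HasGradientAt (fun z => Real.log (heatFlow A t (tiltDensity A B) z))
      (-app (evolved A B t) x) x := by
    rw [hlog, hasGradientAt_iff_hasFDerivAt, map_neg]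
    exact (hasGradientAt_iff_hasFDerivAt.1 hg).neg.const_add _
  rw [velocity, this.gradient, neg_neg]

end HeatFlow

/-! ### Existence and uniqueness of the Kim–Milman map. -/

section KimMilmanMap

variable {t : ℝ}

/-- The identification of matrices with continuous linear maps, as a continuous linear map. -/
def appCLM : Matrix (Fin n) (Fin n) ℝ →L[ℝ] (Space n →L[ℝ] Space n) :=
  LinearMap.toContinuousLinearMap
    (Matrix.toEuclideanCLM (n := Fin n) (𝕜 := ℝ)).toAlgEquiv.toLinearMap

lemma appCLM_apply (M : Matrix (Fin n) (Fin n) ℝ) (x : Space n) : appCLM M x = app M x := rfl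

lemma contDiff_app (M : Matrix (Fin n) (Fin n) ℝ) {k : WithTop ℕ∞} : ContDiff ℝ k (app M) :=
  (appCLM M).contDiff

/-- Along any flow `S` the product `R_s S_s x` has zero derivative, so it equals `x`; this replaces
a uniqueness theorem for the flow. `R` is constrained only at times `t ≥ 0`, so that a time-shifted
propagator is also admissible. -/
lemma inverse_flow_eq_app {R : ℝ → Matrix (Fin n) (Fin n) ℝ} {S Q : ℝ → Space n → Space n}
    (hA : A.PosDef) (hB : B.PosDef) (h0 : R 0 = 1)
    (hR : ∀ t, 0 ≤ t → HasDerivAt R (-(R t * evolved A B t)) t)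
    (hS : IsFlow (velocity A (tiltDensity A B)) S Q) (ht : 0 ≤ t) (y : Space n) :
    Q t y = app (R t) y := by
  set x := Q t y
  have hd : ∀ s, 0 ≤ s → HasDerivWithinAt (fun s => app (R s) (S s x)) 0 (Set.Ici 0) s := by
    intro s hs
    have h1 := (appCLM (n := n)).hasFDerivAt.comp_hasDerivAt s (hR s hs)
    have h2 := hS.ode x s hs
    rw [velocity_tiltDensity hA hB hs] at h2
    refine (h1.hasDerivWithinAt.clm_apply h2).congr_deriv ?_
    rw [map_neg, neg_apply, appCLM_apply, app_mul]
    exact neg_add_cancel _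
  have hc := constant_of_has_deriv_right_zero (a := 0) (b := t)
    (f := fun s => app (R s) (S s x))
    (fun s hs => (hd s hs.1).continuousWithinAt.mono Set.Icc_subset_Ici_self)
    (fun s hs => (hd s hs.1).mono (Set.Ici_subset_Ici.2 hs.1)) t ⟨ht, le_rfl⟩
  simp only [h0, app_one, hS.init] at hc
  rw [← hc, hS.right_inv t ht y]

lemma isKimMilmanMap_eq_app {R : ℝ → Matrix (Fin n) (Fin n) ℝ} {T : Matrix (Fin n) (Fin n) ℝ}
    {T' : Space n → Space n} (hA : A.PosDef) (hB : B.PosDef) (h0 : R 0 = 1)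
    (hR : ∀ t, 0 ≤ t → HasDerivAt R (-(R t * evolved A B t)) t)
    (hT : Tendsto R atTop (𝓝 T)) (hT' : IsKimMilmanMap A (tiltDensity A B) T') :
    T' = app T := by
  obtain ⟨S, Q, hS, τ, hτ, hlim⟩ := hT'
  ext1 y
  have h1 : Tendsto (fun k => Q (τ k) y) atTop (𝓝 (T' y)) :=
    (hlim {y} isCompact_singleton).tendsto_at rfl
  have h2 : Tendsto (fun k => app (R (τ k)) y) atTop (𝓝 (app T y)) :=
    ((((appCLM (n := n)).continuous.clm_apply continuous_const).tendsto T).comp hT).comp hτ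
  refine tendsto_nhds_unique h1 (h2.congr' ?_)
  filter_upwards [hτ.eventually_ge_atTop 0] with k hk
  exact (inverse_flow_eq_app hA hB h0 hR hS hk y).symm

lemma IsPropagator.isKimMilmanMap {Φ R : ℝ → Matrix (Fin n) (Fin n) ℝ}
    {T : Matrix (Fin n) (Fin n) ℝ} (h : IsPropagator A B Φ R T) (hA : A.PosDef) (hB : B.PosDef) :
    IsKimMilmanMap A (tiltDensity A B) (app T) := by
  refine ⟨fun t => app (Φ t), fun t => app (R t), ?_, fun k => k, tendsto_natCast_atTop_atTop, ?_⟩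
  · refine ⟨fun x => by simp [h.zero], fun x t ht => ?_, fun t _ x => ?_, fun t _ x => ?_,
      fun t _ => contDiff_app _, fun t _ => contDiff_app _, ?_⟩
    · have := hasDerivAt_app (h.deriv t) x
      rw [max_eq_left ht, app_mul] at this
      rw [velocity_tiltDensity hA hB ht]
      exact this.hasDerivWithinAt
    · simp [← app_mul, h.inv_mul]
    · simp [← app_mul, h.mul_inv]
    · have hΦ : ContDiff ℝ 1 Φ := by
        refine contDiff_one_iff_deriv.2 ⟨fun t => (h.deriv t).differentiableAt, ?_⟩
        have hΦc : Continuous Φ :=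
          continuous_iff_continuousAt.2 fun t => (h.deriv t).continuousAt
        rw [show _root_.deriv Φ = fun t => evolved A B (max t 0) * Φ t from
          funext fun t => (h.deriv t).deriv]
        exact (continuous_evolved_max hA hB).mul hΦc
      have : ContDiff ℝ 1 fun p : ℝ × Space n => appCLM (Φ p.1) p.2 :=
        (appCLM.contDiff.comp (hΦ.comp contDiff_fst)).clm_apply contDiff_snd
      exact this.locallyLipschitz.locallyLipschitzOn
  · intro K hK
    obtain ⟨C, hC⟩ := hK.isBounded.exists_norm_le
    -- `C` may be negative when `K` is empty, hence the maximum.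
    have hlim : Tendsto (fun k : ℕ => ‖T - R k‖ * max C 0) atTop (𝓝 0) := by
      have h1 := ((h.tendsto.comp tendsto_natCast_atTop_atTop).const_sub T).norm.mul_const (max C 0)
      simpa using! h1
    rw [Metric.tendstoUniformlyOn_iff]
    intro ε hε
    filter_upwards [hlim.eventually_lt_const hε] with k hk x hx
    rw [dist_eq_norm, ← app_sub]
    refine ((norm_app_le _ x).trans ?_).trans_lt hk
    gcongr
    exact (hC x hx).trans (le_max_left _ _)

end KimMilmanMap

/-! ### Brenier maps: existence between Gaussians, and symmetry when linear. -/

section Brenier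

lemma convexOn_half_quad (hM : M.PosSemidef) :
    ConvexOn ℝ Set.univ fun x : Space n => 1 / 2 * quad M x := by
  refine ⟨convex_univ, fun x _ y _ a b ha hb hab => ?_⟩
  have hMt := transpose_eq_of_isHermitian hM.isHermitian
  have hxy : inner ℝ y (app M x) = inner ℝ x (app M y) := by
    rw [real_inner_comm, inner_app_left, hMt]
  have h := quad_nonneg hM (x - y)
  simp only [quad, app_map_sub, app_map_add, app_map_smul, inner_sub_left, inner_sub_right,
    inner_add_left, inner_add_right, real_inner_smul_left, real_inner_smul_right, hxy,
    smul_eq_mul] at h ⊢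
  obtain rfl : b = 1 - a := by linarith
  nlinarith [mul_nonneg (mul_nonneg ha hb) h]

/-- The witness `A^{1/2} (A^{1/2} B A^{1/2})^{-1/2} A^{1/2}` is the positive semidefinite solution
of `T A⁻¹ T = B⁻¹`, and it is the gradient of half its quadratic form. -/
theorem exists_isBrenierMap_gaussian (hA : A.PosDef) (hB : B.PosDef) :
    ∃ T, IsBrenierMap (gaussian A) (gaussian B) T := by
  have hAu : IsUnit A.det := hA.det_pos.ne'.isUnit
  set σ := CFC.sqrt A
  have hσσ : σ * σ = A := CFC.sqrt_mul_sqrt_self A hA.posSemidef.nonneg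
  have hσt : σᵀ = σ := transpose_eq_of_isHermitian
    (Matrix.nonneg_iff_posSemidef.1 (CFC.sqrt_nonneg A)).isHermitian
  have hσu : IsUnit σ.det := by
    rw [← hσσ, Matrix.det_mul] at hAu
    exact isUnit_of_mul_isUnit_left hAu
  have hK : (σ * B * σ).PosSemidef := by
    have := hB.posSemidef.mul_mul_conjTranspose_same σ
    rwa [Matrix.conjTranspose_eq_transpose_of_trivial, hσt] at this
  set κ := CFC.sqrt (σ * B * σ)⁻¹
  have hκκ : κ * κ = (σ * B * σ)⁻¹ := CFC.sqrt_mul_sqrt_self _ hK.inv.nonneg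
  have hκ : κ.PosSemidef := Matrix.nonneg_iff_posSemidef.1 (CFC.sqrt_nonneg _)
  have hL : (σ * κ * σ).PosSemidef := by
    have := hκ.mul_mul_conjTranspose_same σ
    rwa [Matrix.conjTranspose_eq_transpose_of_trivial, hσt] at this
  have hLt := transpose_eq_of_isHermitian hL.isHermitian
  have hσA : σ * A⁻¹ * σ = 1 := by
    rw [← hσσ, Matrix.mul_inv_rev, ← mul_assoc, Matrix.mul_nonsing_inv _ hσu, one_mul,
      Matrix.nonsing_inv_mul _ hσu]
  refine ⟨app (σ * κ * σ), measurePreserving_app_gaussian hA hB ?_, _,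
    convexOn_half_quad hL, Eventually.of_forall fun x => hasGradientAt_half_quad hLt x⟩
  rw [hLt]
  calc σ * κ * σ * A⁻¹ * (σ * κ * σ) = σ * κ * (σ * A⁻¹ * σ) * κ * σ := by simp only [mul_assoc]
    _ = σ * (κ * κ) * σ := by rw [hσA, mul_one, mul_assoc σ κ κ]
    _ = B⁻¹ := by
      rw [hκκ, Matrix.mul_inv_rev, Matrix.mul_inv_rev, ← mul_assoc, ← mul_assoc,
        Matrix.mul_nonsing_inv _ hσu, one_mul, mul_assoc, Matrix.nonsing_inv_mul _ hσu, mul_one]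

lemma add_inner_le_of_hasGradientAt {φ : Space n → ℝ} (hφ : ConvexOn ℝ Set.univ φ)
    {x g : Space n} (hg : HasGradientAt φ g x) (y : Space n) :
    φ x + inner ℝ g (y - x) ≤ φ y := by
  have hline : HasDerivAt (fun s : ℝ => AffineMap.lineMap x y s) (y - x) 0 :=
    AffineMap.hasDerivAt_lineMap
  have hg' : HasFDerivAt φ (InnerProductSpace.toDual ℝ (Space n) g)
      (AffineMap.lineMap x y (0 : ℝ)) := by
    simpa using hasGradientAt_iff_hasFDerivAt.1 hg
  have hd := hg'.comp_hasDerivAt (0 : ℝ) hline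
  have hc : ConvexOn ℝ Set.univ (φ ∘ fun s : ℝ => AffineMap.lineMap x y s) :=
    hφ.comp_affineMap (AffineMap.lineMap x y)
  have h := hc.le_slope_of_hasDerivAt (Set.mem_univ 0) (Set.mem_univ 1) zero_lt_one hd
  simp [slope_def_field] at h
  linarith

/-- A linear map that is almost everywhere the gradient of a convex function is symmetric. -/
theorem transpose_eq_of_ae_hasGradientAt {φ : Space n → ℝ} (hφ : ConvexOn ℝ Set.univ φ)
    (h : ∀ᵐ x, HasGradientAt φ (app M x) x) : Mᵀ = M := by
  have hcont : Continuous φ := continuousOn_univ.1 (hφ.continuousOn isOpen_univ)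
  -- The subgradient inequality is a closed condition on `x` that holds almost everywhere, hence on
  -- a dense set, hence everywhere.
  have hsub : ∀ x y, φ x + inner ℝ (app M x) (y - x) ≤ φ y := by
    intro x y
    have hclosed : IsClosed {x | φ x + inner ℝ (app M x) (y - x) ≤ φ y} :=
      isClosed_le (hcont.add ((continuous_app M).inner (continuous_const.sub continuous_id)))
        continuous_const
    have hdense : Dense {x | φ x + inner ℝ (app M x) (y - x) ≤ φ y} :=
      Measure.dense_of_ae (h.mono fun x hx => add_inner_le_of_hasGradientAt hφ hx y)
    exact hclosed.closure_eq.subset (hdense x)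
  let f' : Space n →L[ℝ] (Space n →L[ℝ] ℝ) :=
    (innerSL ℝ).comp (Matrix.toEuclideanCLM (n := Fin n) (𝕜 := ℝ) M)
  have hf' : ∀ x y, f' x y = inner ℝ (app M x) y := fun x y => rfl
  -- The subgradient inequalities at `x` and at `x + v` trap the first-order error between `0` and
  -- `‖M‖ ‖v‖²`. So `φ` has derivative `M x` everywhere, and symmetry of second derivatives applies.
  have hderiv : ∀ x, HasFDerivAt φ (f' x) x := by
    intro x
    rw [hasFDerivAt_iff_isLittleO_nhds_zero]
    refine Asymptotics.IsBigO.trans_isLittleO (g := fun v : Space n => ‖v‖ ^ 2) ?_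
      (Asymptotics.isLittleO_norm_pow_id one_lt_two)
    refine Asymptotics.IsBigO.of_bound ‖M‖ (Eventually.of_forall fun v => ?_)
    have h1 := hsub x (x + v)
    have h2 := hsub (x + v) x
    rw [add_sub_cancel_left] at h1
    rw [sub_add_cancel_left, app_map_add, inner_add_left, inner_neg_right, inner_neg_right] at h2
    have h3 : inner ℝ (app M v) v ≤ ‖M‖ * ‖v‖ ^ 2 := by
      refine (real_inner_le_norm _ _).trans ?_
      rw [pow_two, ← mul_assoc]
      gcongr
      exact norm_app_le M v
    rw [hf', Real.norm_eq_abs, Real.norm_eq_abs, abs_of_nonneg (by linarith),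
      abs_of_nonneg (by positivity)]
    linarith
  have hsymm : ∀ v w, f' v w = f' w v :=
    fun v w => second_derivative_symmetric (x := 0) hderiv f'.hasFDerivAt v w
  refine app_injective (funext fun x => ext_inner_left ℝ fun v => ?_)
  rw [← inner_app_left, ← hf', hsymm, hf', real_inner_comm]

end Brenier

/-! ### Coincidence of the two maps along the flow forces commutation. -/

section Comparison

variable {t : ℝ}

/-- If the covariance relation `T A⁻¹ T = (A + B)⁻¹` is solved by a symmetric matrix that
commutes with `B`, then `A` and `B` commute. -/
theorem mul_comm_of_symmetric_transport {T : Matrix (Fin n) (Fin n) ℝ} (hA : A.PosDef)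
    (hB : B.PosDef) (hT : Tᵀ = T) (hTA : T * A⁻¹ * Tᵀ = (A + B)⁻¹) (hBT : (B * T)ᵀ = B * T) :
    A * B = B * A := by
  have hconj := (transpose_mul_mul_eq_of_covariance hA (hA.add hB) hTA).2
  rw [hT] at hconj
  have hTB : T * B = B * T := by
    rw [← hBT, Matrix.transpose_mul, hT, transpose_eq_of_isHermitian hB.isHermitian]
  set X := A * B - B * A with hX
  -- Replacing `A` by `A + B` does not change the commutator with `B`; then `T` moves past `B`, and
  -- `T (A + B) T = A`.
  have hTXT : T * X * T = X := by
    have h : X = (A + B) * B - B * (A + B) := by rw [hX]; noncomm_ring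
    calc T * X * T = T * (A + B) * (B * T) - (T * B) * (A + B) * T := by rw [h]; noncomm_ring
      _ = (T * (A + B) * T) * B - B * (T * (A + B) * T) := by
        nth_rewrite 1 [← hTB]
        rw [hTB]
        simp only [mul_assoc]
        rw [hTB]
      _ = X := by rw [hconj]
  have hH : T.IsHermitian := by
    rw [Matrix.IsHermitian, Matrix.conjTranspose_eq_transpose_of_trivial, hT]
  let e := hH.eigenvectorBasis
  have he : ∀ j, app T (e j) = hH.eigenvalues j • e j := fun j =>
    (WithLp.ofLp_injective 2) (hH.mulVec_eigenvectorBasis j)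
  -- On an eigenvector with eigenvalue `l`, `T (A + B) T = A` reads `l² (quad A + quad B) = quad A`,
  -- and `quad B > 0`.
  have hlt : ∀ j, |hH.eigenvalues j| < 1 := by
    intro j
    have hne : e j ≠ 0 := e.orthonormal.ne_zero j
    have h1 : quad (A + B) (app T (e j)) = quad A (e j) := by rw [quad_app, hT, hconj]
    rw [he, quad, app_map_smul, real_inner_smul_left, real_inner_smul_right, ← quad,
      quad_add] at h1
    have hA' := quad_pos hA hne
    have hB' := quad_pos hB hne
    rw [← sq_lt_one_iff_abs_lt_one]
    by_contra! hge
    nlinarith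
  -- In the eigenbasis each entry of `X` equals itself times a product of two eigenvalues, and that
  -- product is not `1`.
  have hzero : ∀ i j, inner ℝ (e i) (app X (e j)) = 0 := by
    intro i j
    have h1 : inner ℝ (e i) (app X (e j))
        = hH.eigenvalues i * hH.eigenvalues j * inner ℝ (e i) (app X (e j)) := by
      conv_lhs => rw [← hTXT, app_mul, app_mul, ← hT, ← inner_app_left, hT, he, he, app_map_smul,
        real_inner_smul_left, real_inner_smul_right, ← mul_assoc]
    have h2 : |hH.eigenvalues i * hH.eigenvalues j| < 1 := by
      rw [abs_mul]
      exact mul_lt_one_of_nonneg_of_lt_one_left (abs_nonneg _) (hlt i) (hlt j).le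
    have h3 : 1 - hH.eigenvalues i * hH.eigenvalues j ≠ 0 := by
      have := (abs_lt.1 h2).2
      linarith
    refine (mul_eq_zero.1 ?_).resolve_left h3
    linear_combination h1
  have hX0 : X = 0 := by
    apply (Matrix.toEuclideanCLM (n := Fin n) (𝕜 := ℝ)).injective
    rw [map_zero]
    refine ContinuousLinearMap.coe_injective (e.toBasis.ext fun j => ?_)
    refine InnerProductSpace.ext_inner_left_basis e.toBasis fun i => ?_
    simpa using! hzero i j
  exact sub_eq_zero.1 hX0

theorem exists_mapsDiffer_evolved (h : NonCommutingPair A B) :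
    ∃ t, 0 ≤ t ∧ MapsDiffer A (evolved A B t) := by
  obtain ⟨hA, hB, hAB⟩ := h
  obtain ⟨Φ, R, T, hP⟩ := exists_isPropagator hA hB
  by_contra! hcon
  have hsymm : ∀ s, 0 ≤ s → (Φ s * T)ᵀ = Φ s * T := by
    intro s hs
    have hB' := posDef_evolved hA hB hs
    have h1 := hcon s hs
    simp only [MapsDiffer, not_forall, not_not] at h1
    obtain ⟨U, U', hU, hU', hUU'⟩ := h1
    -- `Φ_s R_{s+t}` is the inverse propagator started from `B_s`, so the Kim–Milman map for `B_s`
    -- is `Φ_s T`.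
    have hR : ∀ t, 0 ≤ t → HasDerivAt (fun t => Φ s * R (s + t))
        (-(Φ s * R (s + t) * evolved A (evolved A B s) t)) t := by
      intro t ht
      have h2 := (hP.deriv_inv (s + t)).comp_const_add s t
      refine (h2.const_mul (Φ s)).congr_deriv ?_
      rw [max_eq_left (add_nonneg hs ht), evolved_evolved hA hB hs]
      noncomm_ring
    have hlim : Tendsto (fun t => Φ s * R (s + t)) atTop (𝓝 (Φ s * T)) :=
      (hP.tendsto.comp (tendsto_atTop_add_const_left _ s tendsto_id)).const_mul (Φ s)
    have hUeq : U = app (Φ s * T) :=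
      isKimMilmanMap_eq_app hA hB' (by simp [hP.mul_inv]) hR hlim hU
    obtain ⟨φ, hφ, hgrad⟩ := hU'.gradient_convex
    refine transpose_eq_of_ae_hasGradientAt hφ ((ae_gaussian_iff hA).1 ?_)
    filter_upwards [hgrad, hUU'] with x hx hx'
    rwa [← hx', hUeq] at hx
  have hT : Tᵀ = T := by simpa [hP.zero] using hsymm 0 le_rfl
  refine hAB (mul_comm_of_symmetric_transport hA hB hT (hP.limit_mul_inv_mul_transpose hA hB) ?_)
  have hd : HasDerivAt (fun s => Φ s * T) (B * T) 0 := by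
    have := (hP.deriv 0).mul_const T
    rwa [max_self, evolved_zero hB, hP.zero, mul_one] at this
  have hd' := (hasDerivAt_transpose hd).hasDerivWithinAt (s := Set.Ici 0)
  -- Symmetry is known only for `s ≥ 0`, so the derivatives of `Φ_s T` and of its transpose are
  -- compared one-sidedly at `0`.
  exact (uniqueDiffOn_Ici (0 : ℝ) 0 Set.self_mem_Ici).eq_deriv _
    (hd'.congr (fun s hs => (hsymm s hs).symm) (hsymm 0 le_rfl).symm) hd.hasDerivWithinAt

lemma nonCommutingPair_evolved (h : NonCommutingPair A B) (ht : 0 ≤ t) :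
    NonCommutingPair A (evolved A B t) :=
  ⟨h.1, posDef_evolved h.1 h.2.1 ht,
    fun hc => h.2.2 (commute_of_commute_evolved h.1 h.2.1 ht hc).eq⟩

/-- Rank-one perturbations `1 + u uᵀ` and `1 + v vᵀ` of the identity fail to commute when `u` and
`v` are neither parallel nor orthogonal. -/
lemma exists_nonCommutingPair (hn : 2 ≤ n) :
    ∃ A B : Matrix (Fin n) (Fin n) ℝ, NonCommutingPair A B := by
  let i : Fin n := ⟨0, by omega⟩
  let j : Fin n := ⟨1, by omega⟩
  have hij : i ≠ j := by simp [i, j]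
  let u : Fin n → ℝ := Pi.single i 1
  let v : Fin n → ℝ := Pi.single i 1 + Pi.single j 1
  refine ⟨1 + Matrix.vecMulVec u (star u), 1 + Matrix.vecMulVec v (star v),
    Matrix.PosDef.one.add_posSemidef (Matrix.posSemidef_vecMulVec_self_star u),
    Matrix.PosDef.one.add_posSemidef (Matrix.posSemidef_vecMulVec_self_star v), fun h => ?_⟩
  have h1 : Matrix.vecMulVec u (star u) * Matrix.vecMulVec v (star v)
      = Matrix.vecMulVec v (star v) * Matrix.vecMulVec u (star u) := by
    simp only [add_mul, mul_add, one_mul, mul_one] at h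
    rw [add_assoc, add_assoc, add_left_cancel_iff] at h
    rw [add_comm, add_assoc, add_comm] at h
    simpa [add_assoc, add_left_comm, add_comm] using h
  have h2 := congrFun (congrFun h1 i) j
  simp [Matrix.vecMulVec_mul_vecMulVec, Matrix.vecMulVec_apply, u, v, hij, hij.symm] at h2

end Comparison

end KimMilman

end

open KimMilman

theorem mainTheorem1 (n : ℕ) :
    -- both maps are well defined for all pairs of symmetric positive definite matrices
    (∀ A B : Matrix (Fin n) (Fin n) ℝ, A.PosDef → B.PosDef →
      (∃! T, KimMilman.IsKimMilmanMap A (KimMilman.tiltDensity A B) T) ∧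
      (∀ T, KimMilman.IsKimMilmanMap A (KimMilman.tiltDensity A B) T →
        LipschitzWith 1 T ∧
        MeasurePreserving T (KimMilman.gaussian A)
          (KimMilman.target A (KimMilman.tiltDensity A B))) ∧
      (∃ T, KimMilman.IsBrenierMap (KimMilman.gaussian A)
        (KimMilman.target A (KimMilman.tiltDensity A B)) T)) ∧
    -- for every non-commuting pair, the maps differ for some measure along the heat flow
    (∀ A B : Matrix (Fin n) (Fin n) ℝ, KimMilman.NonCommutingPair A B →
      ∃ t : ℝ, 0 ≤ t ∧ ∃ B' : Matrix (Fin n) (Fin n) ℝ, KimMilman.NonCommutingPair A B' ∧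
        KimMilman.heatFlow A t (KimMilman.tiltDensity A B) = KimMilman.tiltDensity A B' ∧
        KimMilman.MapsDiffer A B') ∧
    -- hence in every dimension at least two there is a non-commuting pair for which they differ
    (2 ≤ n → ∃ A B : Matrix (Fin n) (Fin n) ℝ,
      KimMilman.NonCommutingPair A B ∧ KimMilman.MapsDiffer A B) := by
  refine ⟨fun A B hA hB => ?_, fun A B h => ?_, fun hn => ?_⟩
  · obtain ⟨Φ, R, T, hP⟩ := exists_isPropagator hA hB
    have huniq : ∀ T', IsKimMilmanMap A (tiltDensity A B) T' → T' = app T := fun T' hT' =>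
      isKimMilmanMap_eq_app hA hB hP.inv_zero
        (fun t ht => by simpa [max_eq_left ht] using hP.deriv_inv t) hP.tendsto hT'
    rw [target_tiltDensity hA hB]
    refine ⟨⟨app T, hP.isKimMilmanMap hA hB, huniq⟩, fun T' hT' => ?_,
      exists_isBrenierMap_gaussian hA (hA.add hB)⟩
    rw [huniq T' hT']
    refine ⟨LipschitzWith.of_dist_le_mul fun x y => ?_,
      measurePreserving_app_gaussian hA (hA.add hB) (hP.limit_mul_inv_mul_transpose hA hB)⟩
    rw [dist_eq_norm, dist_eq_norm, ← app_map_sub]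
    exact (norm_app_le T _).trans (by gcongr; exact hP.norm_limit_le hA hB)
  · obtain ⟨t, ht, hdiff⟩ := exists_mapsDiffer_evolved h
    exact ⟨t, ht, evolved A B t, nonCommutingPair_evolved h ht,
      heatFlow_tiltDensity h.1 h.2.1 ht, hdiff⟩
  · obtain ⟨A, B, h⟩ := exists_nonCommutingPair hn
    obtain ⟨t, ht, hdiff⟩ := exists_mapsDiffer_evolved h
    exact ⟨A, evolved A B t, nonCommutingPair_evolved h ht, hdiff⟩
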